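/- Let $n\ge 1$, $\alpha\ge 0$, and let $w:\mathbb R^n\to[0,\infty)$ be such that $\Sigma:=\{x: w(x)>0\}$ is a nonempty open convex cone with vertex at the origin, $\log w$ is concave on $\Sigma$, and $w(tx)=t^{\alpha}w(x)$ for all $t>0$, $x\in\Sigma$. Put $d\nu=w\,dx$ on $\Sigma$, $C_w=\big(\int_\Sigma w(x)e^{-|x|^2/2}\,dx\big)^{-1}$ and $d\mu_w=C_w\,w(x)e^{-|x|^2/2}\,dx$ on $\Sigma$. Let $A$ be the set of restrictions to $\overline\Sigma$ of functions $u\in C_c^\infty(\mathbb R^n)$ with $\nabla u\cdot\eta=0$ on $\partial\Sigma$ ($\eta$ the outward normal), and let $W^{1,2}_A(\Sigma,\mu_w)$ be the completion of $A$ under the norm $\big(\int_\Sigma |u|^2d\mu_w\big)^{1/2}+\big(\int_\Sigma|\nabla u|^2d\mu_w\big)^{1/2}$. Write $\mathrm{Ent}_\nu(\varphi)=\int_\Sigma\varphi\log\varphi\,d\nu-\big(\int_\Sigma\varphi\,d\nu\big)\log\big(\int_\Sigma\varphi\,d\nu\big)$. Then for every $f\in W^{1,2}_A(\Sigma,\mu_w)$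 with $\int_\Sigma f^2\,d\nu<\infty$ and $\int_\Sigma|\nabla f|^2\,d\nu<\infty$, the integral $\int_\Sigma f^2\log f^2\,d\nu$ is well defined in $[-\infty,\infty)$ and $$\mathrm{Ent}_{\nu}(f^2)\le\frac{n+\alpha}{2}\int_\Sigma f^2\,d\nu\;\log\!\left(C\,\frac{\int_\Sigma|\nabla f|^2\,d\nu}{\int_\Sigma f^2\,d\nu}\right),\qquad C=C_{\mathrm{LSIH}}:=\frac{4\,C_w^{2/(n+\alpha)}}{e\,(n+\alpha)}$$ (for $f=0$ both sides are read as $0$). The constant is sharp: $C_{\mathrm{LSIH}}$ is the smallest $C>0$ for which the inequality holds for all such $f$. Moreover, for every $a\in\mathbb R$ the Gaussian $f(x)=a\,e^{-|x|^2/4}$ belongs to this class of functions and gives equality with $C=C_{\mathrm{LSIH}}$. -/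

import Mathlib

open MeasureTheory Filter
open scoped Topology ENNReal ContDiff

noncomputable section

namespace WeightedLSI

variable {n : ℕ}

/-- The positivity set `Σ = {w > 0}` of the weight. -/
def support (w : EuclideanSpace ℝ (Fin n) → ℝ) : Set (EuclideanSpace ℝ (Fin n)) :=
  {x | 0 < w x}

/-- `w : ℝⁿ → [0, ∞)` is log-concave and homogeneous of degree `α ≥ 0`, and `Σ = {w > 0}` is a
nonempty open convex cone with vertex at the origin. Convexity of `Σ` is part of `ConcaveOn`,
and `Σ` is stable under positive dilations by homogeneity. -/
structure IsHomogeneousLogConcave (α : ℝ) (w : EuclideanSpace ℝ (Fin n) → ℝ) : Prop where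
  nonneg : ∀ x, 0 ≤ w x
  isOpen_support : IsOpen (support w)
  nonempty_support : (support w).Nonempty
  logConcave : ConcaveOn ℝ (support w) (fun x => Real.log (w x))
  degree_nonneg : 0 ≤ α
  homogeneous : ∀ t : ℝ, 0 < t → ∀ x ∈ support w, w (t • x) = t ^ α * w x

/-- The measure `dν = w dx` on `Σ`. -/
def nu (w : EuclideanSpace ℝ (Fin n) → ℝ) : Measure (EuclideanSpace ℝ (Fin n)) :=
  (volume.restrict (support w)).withDensity (fun x => ENNReal.ofReal (w x))

/-- The constant `C_w = (∫_Σ w(x) e^{-|x|²/2} dx)⁻¹`. -/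
def normConst (w : EuclideanSpace ℝ (Fin n) → ℝ) : ℝ :=
  (∫ x in support w, w x * Real.exp (-‖x‖ ^ 2 / 2))⁻¹

/-- The weighted Gaussian probability measure `dμ_w = C_w w(x) e^{-|x|²/2} dx` on `Σ`. -/
def mu (w : EuclideanSpace ℝ (Fin n) → ℝ) : Measure (EuclideanSpace ℝ (Fin n)) :=
  (volume.restrict (support w)).withDensity
    (fun x => ENNReal.ofReal (normConst w * (w x * Real.exp (-‖x‖ ^ 2 / 2))))

/-- `η` is an outward normal vector of the convex set `S` at `x`. -/
def IsOutwardNormal (S : Set (EuclideanSpace ℝ (Fin n))) (x η : EuclideanSpace ℝ (Fin n)) :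
    Prop :=
  ∀ y ∈ S, inner ℝ η (y - x) ≤ 0

/-- The class `A` of all `u ∈ C_0^∞(closure Σ)` (restrictions of smooth compactly supported
functions on `ℝⁿ`; they need not vanish on `∂Σ`) with `∇u · η = 0` on `∂Σ`. The condition is
imposed for every outward normal. As `∇u` is continuous and the normal cone of an open convex set
at a boundary point is generated by limits of the unit normals at nearby regular boundary points,
this is the same as imposing it at the regular boundary points only. -/
def IsTestFunction (w : EuclideanSpace ℝ (Fin n) → ℝ) (u : EuclideanSpace ℝ (Fin n) → ℝ) : Prop :=
  ContDiff ℝ ∞ u ∧ HasCompactSupport u ∧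
    ∀ x ∈ frontier (support w), ∀ η, IsOutwardNormal (support w) x η →
      inner ℝ (gradient u x) η = 0

/-- `f` belongs to `W^{1,2}_A(Σ, μ_w)`, with gradient `g`. The completion of `A` under
`‖u‖_{L²(μ_w)} + ‖∇u‖_{L²(μ_w)}` is realized as the closure of the graph `{(u, ∇u) : u ∈ A}` in
`L²(μ_w) × L²(μ_w; ℝⁿ)`. For the weights considered `w` is locally bounded below on `Σ`, so that
`g` is the weak gradient of `f` on `Σ`, and is determined by `f` almost everywhere. -/
def MemSobolev (w : EuclideanSpace ℝ (Fin n) → ℝ) (f : EuclideanSpace ℝ (Fin n) → ℝ)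
    (g : EuclideanSpace ℝ (Fin n) → EuclideanSpace ℝ (Fin n)) : Prop :=
  MemLp f 2 (mu w) ∧ MemLp g 2 (mu w) ∧
    ∃ u : ℕ → EuclideanSpace ℝ (Fin n) → ℝ, (∀ k, IsTestFunction w (u k)) ∧
      Tendsto (fun k => eLpNorm (fun x => u k x - f x) 2 (mu w) +
        eLpNorm (fun x => gradient (u k) x - g x) 2 (mu w)) atTop (𝓝 0)

/-- `f ∈ W^{1,2}_A(Σ, μ_w)` with gradient `g`, and both `∫_Σ f² dν` and `∫_Σ |∇f|² dν` are
finite. -/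
def Admissible (w : EuclideanSpace ℝ (Fin n) → ℝ) (f : EuclideanSpace ℝ (Fin n) → ℝ)
    (g : EuclideanSpace ℝ (Fin n) → EuclideanSpace ℝ (Fin n)) : Prop :=
  MemSobolev w f g ∧ MemLp f 2 (nu w) ∧ MemLp g 2 (nu w)

/-- `∫ (φ log φ)⁺ dν`. -/
def entPos (ν : Measure (EuclideanSpace ℝ (Fin n))) (φ : EuclideanSpace ℝ (Fin n) → ℝ) : ℝ≥0∞ :=
  ∫⁻ x, ENNReal.ofReal (φ x * Real.log (φ x)) ∂ν

/-- `∫ (φ log φ)⁻ dν`. -/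
def entNeg (ν : Measure (EuclideanSpace ℝ (Fin n))) (φ : EuclideanSpace ℝ (Fin n) → ℝ) : ℝ≥0∞ :=
  ∫⁻ x, ENNReal.ofReal (-(φ x * Real.log (φ x))) ∂ν

/-- `Ent_ν(φ) = ∫ φ log φ dν - (∫ φ dν) log (∫ φ dν)`, for `φ ≥ 0` integrable. As `ν` is an
infinite measure, `∫ φ log φ dν` may be `-∞`; it is taken with values in `[-∞, ∞]`, as the
difference of the integrals of the positive and the negative part. -/
def ent (ν : Measure (EuclideanSpace ℝ (Fin n))) (φ : EuclideanSpace ℝ (Fin n) → ℝ) : EReal :=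
  ((entPos ν φ : ℝ≥0∞) : EReal) - ((entNeg ν φ : ℝ≥0∞) : EReal)
    - (((∫ x, φ x ∂ν) * Real.log (∫ x, φ x ∂ν) : ℝ) : EReal)

/-- The right-hand side
`((n + α) / 2) ∫_Σ f² dν · log (C ∫_Σ |∇f|² dν / ∫_Σ f² dν)`, where `g = ∇f`. -/
def lsiRHS (w : EuclideanSpace ℝ (Fin n) → ℝ) (α C : ℝ) (f : EuclideanSpace ℝ (Fin n) → ℝ)
    (g : EuclideanSpace ℝ (Fin n) → EuclideanSpace ℝ (Fin n)) : ℝ :=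
  (n + α) / 2 * (∫ x, f x ^ 2 ∂(nu w)) *
    Real.log (C * ((∫ x, ‖g x‖ ^ 2 ∂(nu w)) / ∫ x, f x ^ 2 ∂(nu w)))

/-- The logarithmic Sobolev inequality for `ν` with constant `C`. -/
def LSI (w : EuclideanSpace ℝ (Fin n) → ℝ) (α C : ℝ) : Prop :=
  ∀ f g, Admissible w f g → ent (nu w) (fun x => f x ^ 2) ≤ ((lsiRHS w α C f g : ℝ) : EReal)

/-- `C_LSIH = 4 C_w^{2/(n+α)} / (e (n+α))`. -/
def sharpConst (w : EuclideanSpace ℝ (Fin n) → ℝ) (α : ℝ) : ℝ :=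
  4 * normConst w ^ (2 / (n + α)) / (Real.exp 1 * (n + α))

/-- The Gaussian `A e^{-|x|²/4}`. -/
def gaussian (A : ℝ) (x : EuclideanSpace ℝ (Fin n)) : ℝ :=
  A * Real.exp (-‖x‖ ^ 2 / 4)

end WeightedLSI

end

/-! The density of `mu w` is a Gaussian times a log-concave function on a convex cone, so it is at
least as log-concave as the standard Gaussian. Prékopa–Leindler, applied to `e^u` times this density
and to the density itself, gives a hypercontractive estimate (`log_integral_exp_le`). Its derivative
at `d = 0` is the logarithmic Sobolev inequality for `mu w` with the Gaussian constant
(`ent_exp_le`, `ent_sq_mu_le`).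

Substituting `F = f e^{|x|²/4}` turns this into an inequality for `nu w`. The second moments of `f²`
cancel. The cross term `f ⟨∇f, x⟩` is evaluated by Euler's identity `integral_fderiv_apply_self`,
which comes from differentiating the scaling law of `nu w` under dilations; the homogeneous
dimension `n + α` enters here. Applying the result to `f(t x)` gives one additive inequality for
each `t > 0` (`integral_mul_log_sq_le`), and optimizing over `t` (`le_optimized`) gives the
logarithmic form.

The extension to the Sobolev class uses radial cutoffs: on a ball `nu w` is dominated by a multiple
of `mu w`, so cut-off test functions converge in the norms of `nu w`, and Fatou's lemma carries the
inequality over. Since `nu w` is infinite, `entPos_sq_le` bounds the positive part of `f² log f²`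
separately.

For sharpness, Euler's identity gives the second moment of the Gaussian, and both sides become
explicit and equal. The Gaussian is admissible because `⟨x, η⟩ = 0` at boundary points of a cone, so
radial functions satisfy the boundary condition. -/

noncomputable section

/-! ### The Prékopa–Leindler inequality, by induction on the dimension. -/

namespace PrekopaLeindler

open Set Pointwise

/-- `t K + s (min L)` lies to the left of the point `t (max K) + s (min L)` and `t (max K) + s L` to
its right. Both are contained in `C` and they overlap in at most that point, so their volumes add.
-/
lemma add_volume_le_of_isCompact {t s : ℝ} (ht : 0 < t) (hs : 0 < s) {K L C : Set ℝ}
    (hK : IsCompact K) (hL : IsCompact L) (hKn : K.Nonempty) (hLn : L.Nonempty)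
    (hC : ∀ x ∈ K, ∀ y ∈ L, t * x + s * y ∈ C) :
    ENNReal.ofReal t * volume K + ENNReal.ofReal s * volume L ≤ volume C := by
  set k := sSup K
  set l := sInf L
  have hk : k ∈ K := hK.sSup_mem hKn
  have hl : l ∈ L := hL.sInf_mem hLn
  set P : Set ℝ := (s * l) +ᵥ (t • K)
  set Q : Set ℝ := (t * k) +ᵥ (s • L)
  have hP : volume P = ENNReal.ofReal t * volume K := by
    simp [P, measure_vadd, Measure.addHaar_smul, abs_of_pos ht]
  have hQ : volume Q = ENNReal.ofReal s * volume L := by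
    simp [Q, measure_vadd, Measure.addHaar_smul, abs_of_pos hs]
  have hQc : IsCompact Q := (hL.smul s).vadd (t * k)
  have hsub : P ∪ Q ⊆ C := by
    rintro _ (⟨_, ⟨x, hx, rfl⟩, rfl⟩ | ⟨_, ⟨x, hx, rfl⟩, rfl⟩)
    · simpa [add_comm] using hC x hx l hl
    · simpa [add_comm] using hC k hk x hx
  have hdisj : AEDisjoint volume P Q := by
    refine measure_mono_null (t := {s * l + t * k}) ?_ (by simp)
    rintro _ ⟨⟨_, ⟨x, hx, rfl⟩, rfl⟩, ⟨_, ⟨y, hy, rfl⟩, h⟩⟩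
    have h1 : x ≤ k := le_csSup hK.bddAbove hx
    have h2 : l ≤ y := csInf_le hL.bddBelow hy
    simp only [vadd_eq_add, smul_eq_mul, mem_singleton_iff] at h ⊢
    nlinarith
  calc _ = volume (P ∪ Q) := by
        rw [measure_union₀ hQc.measurableSet.nullMeasurableSet hdisj, hP, hQ]
    _ ≤ volume C := measure_mono hsub

/-- The one-dimensional Brunn-Minkowski inequality. -/
lemma add_volume_le {t s : ℝ} (ht : 0 < t) (hs : 0 < s) {A B C : Set ℝ}
    (hA : MeasurableSet A) (hB : MeasurableSet B) (hAn : A.Nonempty) (hBn : B.Nonempty)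
    (hC : ∀ x ∈ A, ∀ y ∈ B, t * x + s * y ∈ C) :
    ENNReal.ofReal t * volume A + ENNReal.ofReal s * volume B ≤ volume C := by
  -- Inner regularity, with a point of `D` adjoined to each compact set so that it is nonempty.
  have key : ∀ {D : Set ℝ}, MeasurableSet D → D.Nonempty →
      Nonempty {K : Set ℝ // K ⊆ D ∧ IsCompact K ∧ K.Nonempty} ∧
      volume D ≤ ⨆ K : {K : Set ℝ // K ⊆ D ∧ IsCompact K ∧ K.Nonempty}, volume K.1 := by
    rintro D hD ⟨d, hd⟩
    refine ⟨⟨{d}, by simpa using hd, isCompact_singleton, singleton_nonempty d⟩, ?_⟩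
    rw [hD.measure_eq_iSup_isCompact]
    refine iSup₂_le fun K hK => iSup_le fun hKc => ?_
    exact (measure_mono subset_union_left).trans
      (le_iSup (fun K : {K : Set ℝ // K ⊆ D ∧ IsCompact K ∧ K.Nonempty} => volume K.1)
        ⟨K ∪ {d}, union_subset hK (by simpa using hd), hKc.union isCompact_singleton,
          ⟨d, by simp⟩⟩)
  obtain ⟨i1, h1⟩ := key hA hAn
  obtain ⟨i2, h2⟩ := key hB hBn
  refine (add_le_add (mul_le_mul_right h1 _) (mul_le_mul_right h2 _)).trans ?_
  rw [ENNReal.mul_iSup, ENNReal.mul_iSup]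
  refine ENNReal.iSup_add_iSup_le fun K L => ?_
  exact add_volume_le_of_isCompact ht hs K.2.2.1 L.2.2.1 K.2.2.2 L.2.2.2
    fun x hx y hy => hC x (K.2.1 hx) y (L.2.1 hy)

/-- Layer-cake formula plus Brunn–Minkowski at each level `r`. Since `u` and `v` both have supremum
`1`, their superlevel sets are nonempty for the same levels `r < 1`. -/
lemma lintegral_add_le_of_normalized {t s : ℝ} (ht : 0 < t) (hs : 0 < s) (hts : t + s = 1)
    {u v : ℝ → ℝ} {h : ℝ → ℝ≥0∞} (hu : Measurable u) (hv : Measurable v) (hh : Measurable h)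
    (hu0 : ∀ x, 0 ≤ u x) (hv0 : ∀ x, 0 ≤ v x) (hu1 : ∀ x, u x ≤ 1) (hv1 : ∀ x, v x ≤ 1)
    (hus : ∀ r < 1, ∃ x, r < u x) (hvs : ∀ r < 1, ∃ x, r < v x)
    (H : ∀ x y, ENNReal.ofReal (u x ^ t * v y ^ s) ≤ h (t * x + s * y)) :
    ENNReal.ofReal t * (∫⁻ x, ENNReal.ofReal (u x)) +
      ENNReal.ofReal s * (∫⁻ x, ENNReal.ofReal (v x)) ≤ ∫⁻ x, h x := by
  -- Truncating `h` at `1` makes it real-valued and keeps the hypothesis, since `u ^ t * v ^ s ≤ 1`.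
  set k : ℝ → ℝ := fun x => (min (h x) 1).toReal
  have hkm : Measurable k := (hh.min measurable_const).ennreal_toReal
  have hk : ∀ x y, u x ^ t * v y ^ s ≤ k (t * x + s * y) := by
    intro x y
    have h1 : u x ^ t * v y ^ s ≤ 1 :=
      mul_le_one₀ (Real.rpow_le_one (hu0 x) (hu1 x) ht.le) (Real.rpow_nonneg (hv0 y) _)
        (Real.rpow_le_one (hv0 y) (hv1 y) hs.le)
    rw [← ENNReal.ofReal_le_iff_le_toReal (by simp)]
    exact le_min (H x y) (by simpa using h1)
  have hkh : ∫⁻ x, ENNReal.ofReal (k x) ≤ ∫⁻ x, h x := by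
    refine lintegral_mono fun x => ?_
    simp only [k]
    rw [ENNReal.ofReal_toReal (by simp)]
    exact min_le_left _ _
  refine le_trans ?_ hkh
  have anti : ∀ f : ℝ → ℝ, Measurable fun r : ℝ => volume {a | r < f a} := fun f =>
    (show Antitone fun r : ℝ => volume {a | r < f a} from
      fun r r' hr => measure_mono fun a (ha : r' < f a) => lt_of_le_of_lt hr ha).measurable
  rw [lintegral_eq_lintegral_meas_lt _ (ae_of_all _ hu0) hu.aemeasurable,
    lintegral_eq_lintegral_meas_lt _ (ae_of_all _ hv0) hv.aemeasurable,
    lintegral_eq_lintegral_meas_lt _ (ae_of_all _ fun x => ENNReal.toReal_nonneg) hkm.aemeasurable,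
    ← lintegral_const_mul _ (anti u), ← lintegral_const_mul _ (anti v),
    ← lintegral_add_left ((anti u).const_mul _)]
  refine setLIntegral_mono' measurableSet_Ioi fun r (hr : 0 < r) => ?_
  rcases lt_or_ge r 1 with h1 | h1
  · refine add_volume_le ht hs (measurableSet_lt measurable_const hu)
      (measurableSet_lt measurable_const hv) (hus r h1) (hvs r h1) fun x hx y hy => ?_
    refine lt_of_lt_of_le ?_ (hk x y)
    calc r = r ^ t * r ^ s := by rw [← Real.rpow_add hr, hts, Real.rpow_one]
      _ < u x ^ t * v y ^ s := mul_lt_mul'' (Real.rpow_lt_rpow hr.le hx ht)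
          (Real.rpow_lt_rpow hr.le hy hs) (by positivity) (by positivity)
  · have e1 : {a | r < u a} = ∅ := eq_empty_of_forall_notMem fun a ha =>
      absurd (lt_of_le_of_lt h1 ha) (not_lt.2 (hu1 a))
    have e2 : {a | r < v a} = ∅ := eq_empty_of_forall_notMem fun a ha =>
      absurd (lt_of_le_of_lt h1 ha) (not_lt.2 (hv1 a))
    simp [e1, e2]

lemma rpow_mul_rpow_le_add {t s : ℝ} (ht : 0 < t) (hs : 0 < s) (hts : t + s = 1) (a b : ℝ≥0∞) :
    a ^ t * b ^ s ≤ ENNReal.ofReal t * a + ENNReal.ofReal s * b := by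
  by_cases ha : a = ⊤
  · simp [ha, ENNReal.mul_top, ht]
  by_cases hb : b = ⊤
  · simp [hb, ENNReal.mul_top, hs]
  lift a to NNReal using ha
  lift b to NNReal using hb
  have := NNReal.geom_mean_le_arith_mean2_weighted t.toNNReal s.toNNReal a b
    (by rw [← Real.toNNReal_add ht.le hs.le, hts]; simp)
  rw [Real.coe_toNNReal _ ht.le, Real.coe_toNNReal _ hs.le] at this
  rw [← ENNReal.coe_rpow_of_nonneg _ ht.le, ← ENNReal.coe_rpow_of_nonneg _ hs.le]
  simp only [ENNReal.ofReal]
  exact_mod_cast this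

/-- Divide `u` and `v` by their suprema and weaken the resulting additive inequality by the
arithmetic–geometric mean inequality. Both sides then carry the same factor `c`, which cancels. -/
lemma rpow_lintegral_mul_le_of_bounded {t s : ℝ} (ht : 0 < t) (hs : 0 < s) (hts : t + s = 1)
    {u v : ℝ → ℝ} {h : ℝ → ℝ≥0∞} (hu : Measurable u) (hv : Measurable v) (hh : Measurable h)
    (hu0 : ∀ x, 0 ≤ u x) (hv0 : ∀ x, 0 ≤ v x) {N : ℝ} (hu1 : ∀ x, u x ≤ N) (hv1 : ∀ x, v x ≤ N)
    (H : ∀ x y, ENNReal.ofReal (u x ^ t * v y ^ s) ≤ h (t * x + s * y)) :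
    (∫⁻ x, ENNReal.ofReal (u x)) ^ t * (∫⁻ x, ENNReal.ofReal (v x)) ^ s ≤ ∫⁻ x, h x := by
  by_cases hu2 : ∀ x, u x = 0
  · simp [hu2, ht]
  by_cases hv2 : ∀ x, v x = 0
  · simp [hv2, hs]
  push Not at hu2 hv2
  obtain ⟨x₀, hx₀⟩ := hu2
  obtain ⟨y₀, hy₀⟩ := hv2
  set a := ⨆ x, u x
  set b := ⨆ x, v x
  have hba : BddAbove (range u) := ⟨N, by rintro _ ⟨x, rfl⟩; exact hu1 x⟩
  have hbb : BddAbove (range v) := ⟨N, by rintro _ ⟨x, rfl⟩; exact hv1 x⟩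
  have ha : 0 < a := lt_of_lt_of_le (lt_of_le_of_ne (hu0 _) (Ne.symm hx₀)) (le_ciSup hba x₀)
  have hb : 0 < b := lt_of_lt_of_le (lt_of_le_of_ne (hv0 _) (Ne.symm hy₀)) (le_ciSup hbb y₀)
  set c := a⁻¹ ^ t * b⁻¹ ^ s
  have hc : 0 < c := by positivity
  have key := lintegral_add_le_of_normalized ht hs hts (u := fun x => a⁻¹ * u x)
    (v := fun x => b⁻¹ * v x) (h := fun x => ENNReal.ofReal c * h x)
    (hu.const_mul _) (hv.const_mul _) (hh.const_mul _)
    (fun x => mul_nonneg (by positivity) (hu0 x)) (fun x => mul_nonneg (by positivity) (hv0 x))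
    (fun x => by rw [inv_mul_le_one₀ ha]; exact le_ciSup hba x)
    (fun x => by rw [inv_mul_le_one₀ hb]; exact le_ciSup hbb x)
    (fun r hr => by
      obtain ⟨x, hx⟩ := exists_lt_of_lt_ciSup (show a * r < ⨆ x, u x from by
        change _ < a; nlinarith)
      exact ⟨x, by rwa [lt_inv_mul_iff₀ ha]⟩)
    (fun r hr => by
      obtain ⟨x, hx⟩ := exists_lt_of_lt_ciSup (show b * r < ⨆ x, v x from by
        change _ < b; nlinarith)
      exact ⟨x, by rwa [lt_inv_mul_iff₀ hb]⟩)
    (fun x y => by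
      rw [Real.mul_rpow (by positivity) (hu0 x), Real.mul_rpow (by positivity) (hv0 y),
        mul_mul_mul_comm, ENNReal.ofReal_mul hc.le]
      exact mul_le_mul_right (H x y) _)
  have key2 := (rpow_mul_rpow_le_add ht hs hts _ _).trans key
  simp_rw [ENNReal.ofReal_mul (inv_nonneg.2 ha.le), ENNReal.ofReal_mul (inv_nonneg.2 hb.le)] at key2
  rw [lintegral_const_mul _ hu.ennreal_ofReal, lintegral_const_mul _ hv.ennreal_ofReal,
    lintegral_const_mul _ hh, ENNReal.mul_rpow_of_nonneg _ _ ht.le,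
    ENNReal.mul_rpow_of_nonneg _ _ hs.le, mul_mul_mul_comm,
    ENNReal.ofReal_rpow_of_nonneg (by positivity) ht.le,
    ENNReal.ofReal_rpow_of_nonneg (by positivity) hs.le, ← ENNReal.ofReal_mul (by positivity)]
    at key2
  exact (ENNReal.mul_le_mul_iff_right (by simpa using hc) (by simp)).1 key2

lemma lintegral_eq_iSup_min {f : ℝ → ℝ≥0∞} (hf : Measurable f) :
    ∫⁻ x, f x = ⨆ N : ℕ, ∫⁻ x, ENNReal.ofReal (min (f x) N).toReal := by
  have h1 : ∀ (N : ℕ) x, ENNReal.ofReal (min (f x) N).toReal = min (f x) N := fun N x =>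
    ENNReal.ofReal_toReal (by simp)
  simp_rw [h1]
  rw [← lintegral_iSup (fun N => hf.min measurable_const)
    (fun N M hNM x => min_le_min_left _ (by simpa using hNM))]
  refine lintegral_congr fun x => ?_
  change f x = ⨆ N : ℕ, f x ⊓ (N : ℝ≥0∞)
  rw [← inf_iSup_eq, ENNReal.iSup_natCast, inf_top_eq]

/-- The one-dimensional Prékopa–Leindler inequality. -/
lemma rpow_lintegral_mul_le_real {t s : ℝ} (ht : 0 < t) (hs : 0 < s) (hts : t + s = 1)
    {u v h : ℝ → ℝ≥0∞} (hu : Measurable u) (hv : Measurable v) (hh : Measurable h)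
    (H : ∀ x y, u x ^ t * v y ^ s ≤ h (t * x + s * y)) :
    (∫⁻ x, u x) ^ t * (∫⁻ x, v x) ^ s ≤ ∫⁻ x, h x := by
  have mono : ∀ f : ℝ → ℝ≥0∞, Monotone fun N : ℕ => ∫⁻ x, ENNReal.ofReal (min (f x) N).toReal :=
    fun f N M hNM => lintegral_mono fun x => ENNReal.ofReal_le_ofReal
      (ENNReal.toReal_mono (by simp) (min_le_min_left _ (by simpa using hNM)))
  have tend : ∀ {f : ℝ → ℝ≥0∞}, Measurable f → Tendsto
      (fun N : ℕ => ∫⁻ x, ENNReal.ofReal (min (f x) N).toReal) atTop (𝓝 (∫⁻ x, f x)) := by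
    intro f hf
    rw [lintegral_eq_iSup_min hf]
    exact tendsto_atTop_iSup (mono f)
  have main : ∀ N : ℕ, (∫⁻ x, ENNReal.ofReal (min (u x) N).toReal) ^ t *
      (∫⁻ x, ENNReal.ofReal (min (v x) N).toReal) ^ s ≤ ∫⁻ x, h x := by
    intro N
    have hle : ∀ (f : ℝ → ℝ≥0∞) x, (min (f x) N).toReal ≤ N := fun f x =>
      ENNReal.toReal_le_of_le_ofReal (by positivity) (by simp)
    refine rpow_lintegral_mul_le_of_bounded ht hs hts (hu.min measurable_const).ennreal_toReal
      (hv.min measurable_const).ennreal_toReal hh (fun _ => ENNReal.toReal_nonneg)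
      (fun _ => ENNReal.toReal_nonneg) (hle u) (hle v) fun x y => ?_
    rw [ENNReal.ofReal_mul (by positivity), ← ENNReal.ofReal_rpow_of_nonneg (by positivity) ht.le,
      ← ENNReal.ofReal_rpow_of_nonneg (by positivity) hs.le, ENNReal.ofReal_toReal (by simp),
      ENNReal.ofReal_toReal (by simp)]
    exact (mul_le_mul' (ENNReal.rpow_le_rpow (min_le_left _ _) ht.le)
      (ENNReal.rpow_le_rpow (min_le_left _ _) hs.le)).trans (H x y)
  -- Multiplication on `ℝ≥0∞` is discontinuous at `(0, ∞)`, so vanishing integrals are treated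
  -- before the limit.
  rcases eq_or_ne (∫⁻ x, u x) 0 with hu0 | hu0
  · simp [hu0, ht]
  rcases eq_or_ne (∫⁻ x, v x) 0 with hv0 | hv0
  · simp [hv0, hs]
  refine le_of_tendsto (ENNReal.Tendsto.mul ((ENNReal.continuous_rpow_const.tendsto _).comp
    (tend hu)) (Or.inl ?_) ((ENNReal.continuous_rpow_const.tendsto _).comp (tend hv)) (Or.inl ?_))
    (Eventually.of_forall main)
  · simp [ENNReal.rpow_eq_zero_iff, hu0, ht.le]
  · simp [ENNReal.rpow_eq_zero_iff, hv0, hs.le]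

/-- The Prékopa–Leindler inequality on `Fin n → ℝ`. -/
lemma rpow_lintegral_mul_le_pi {t s : ℝ} (ht : 0 < t) (hs : 0 < s) (hts : t + s = 1) (n : ℕ)
    {u v h : (Fin n → ℝ) → ℝ≥0∞} (hu : Measurable u) (hv : Measurable v) (hh : Measurable h)
    (H : ∀ x y, u x ^ t * v y ^ s ≤ h (t • x + s • y)) :
    (∫⁻ x, u x) ^ t * (∫⁻ x, v x) ^ s ≤ ∫⁻ x, h x := by
  induction n with
  | zero =>
    have e : ∀ f : (Fin 0 → ℝ) → ℝ≥0∞, ∫⁻ x, f x = f 0 := by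
      intro f
      rw [volume_pi, Measure.pi_of_empty _ 0, lintegral_dirac]
    rw [e, e, e]
    simpa using H 0 0
  | succ n ih =>
    have e : ∀ {f : (Fin (n + 1) → ℝ) → ℝ≥0∞}, Measurable f →
        (Measurable fun a : ℝ => ∫⁻ z : Fin n → ℝ, f (Fin.cons a z)) ∧
        (∀ a : ℝ, Measurable fun z : Fin n → ℝ => f (Fin.cons a z)) ∧
        ∫⁻ x, f x = ∫⁻ a : ℝ, ∫⁻ z : Fin n → ℝ, f (Fin.cons a z) := by
      intro f hf
      have mp := (volume_preserving_piFinSuccAbove (fun _ : Fin (n + 1) => ℝ) 0).symm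
      have hm : Measurable fun p : ℝ × (Fin n → ℝ) => f (Fin.cons p.1 p.2) := by
        have := hf.comp (MeasurableEquiv.piFinSuccAbove (fun _ : Fin (n + 1) => ℝ) 0).symm.measurable
        convert this using 2
        simp [MeasurableEquiv.piFinSuccAbove, Fin.insertNthEquiv]
      refine ⟨hm.lintegral_prod_right', fun a => hm.comp measurable_prodMk_left, ?_⟩
      rw [← mp.lintegral_comp hf, Measure.volume_eq_prod, lintegral_prod]
      · simp [MeasurableEquiv.piFinSuccAbove, Fin.insertNthEquiv]
      · convert hm.aemeasurable using 2
        simp [MeasurableEquiv.piFinSuccAbove, Fin.insertNthEquiv]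
    obtain ⟨hu1, hu2, hu3⟩ := e hu
    obtain ⟨hv1, hv2, hv3⟩ := e hv
    obtain ⟨hh1, hh2, hh3⟩ := e hh
    rw [hu3, hv3, hh3]
    -- The integrals over slices satisfy the one-dimensional hypothesis, by the induction hypothesis
    -- on each pair of slices.
    refine rpow_lintegral_mul_le_real ht hs hts hu1 hv1 hh1 fun a b => ?_
    refine ih (hu2 a) (hv2 b) (hh2 _) fun x y => ?_
    refine (H _ _).trans (le_of_eq ?_)
    congr 1
    ext i
    refine Fin.cases ?_ (fun i => ?_) i <;> simp

/-- The **Prékopa–Leindler inequality** on `ℝⁿ`. -/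
theorem rpow_lintegral_mul_le {t s : ℝ} (ht : 0 < t) (hs : 0 < s) (hts : t + s = 1) {n : ℕ}
    {u v h : EuclideanSpace ℝ (Fin n) → ℝ≥0∞} (hu : Measurable u) (hv : Measurable v)
    (hh : Measurable h) (H : ∀ x y, u x ^ t * v y ^ s ≤ h (t • x + s • y)) :
    (∫⁻ x, u x) ^ t * (∫⁻ x, v x) ^ s ≤ ∫⁻ x, h x := by
  have mp := PiLp.volume_preserving_toLp (Fin n)
  rw [← mp.lintegral_comp hu, ← mp.lintegral_comp hv, ← mp.lintegral_comp hh]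
  exact rpow_lintegral_mul_le_pi ht hs hts n (hu.comp mp.measurable) (hv.comp mp.measurable)
    (hh.comp mp.measurable) fun x y => by simpa using H (WithLp.toLp 2 x) (WithLp.toLp 2 y)

end PrekopaLeindler

namespace WeightedLSI

local notation "𝔼" n => EuclideanSpace ℝ (Fin n)

/-! ### The measures `nu w` and `mu w`: growth, scaling, Euler's identity, Prékopa–Leindler. -/

section Weight

variable {n : ℕ} {α : ℝ} {w : (𝔼 n) → ℝ}

/-- A non-integrable function has integral `0` by convention, whereas the Gaussian integral formula
gives a positive value. -/
lemma integrable_exp_neg_mul_sq_norm {c : ℝ} (hc : 0 < c) :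
    Integrable (fun x : 𝔼 n => Real.exp (-c * ‖x‖ ^ 2)) := by
  by_contra h
  have := GaussianFourier.integral_rexp_neg_mul_sq_norm (V := 𝔼 n) hc
  rw [integral_undef h] at this
  have : 0 < (Real.pi / c) ^ ((Module.finrank ℝ (𝔼 n) : ℝ) / 2) := by positivity
  linarith

lemma eq_zero_of_notMem (hw : IsHomogeneousLogConcave α w) {x : 𝔼 n} (hx : x ∉ support w) :
    w x = 0 :=
  le_antisymm (not_lt.1 hx) (hw.nonneg x)

/-- A concave function is continuous on an open set in finite dimension, so `w` is continuous on its
support; elsewhere it is zero. -/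
lemma measurable_weight (hw : IsHomogeneousLogConcave α w) : Measurable w := by
  classical
  have hc : ContinuousOn w (support w) := by
    refine (Real.continuous_exp.comp_continuousOn
      (hw.logConcave.continuousOn hw.isOpen_support)).congr fun x hx => ?_
    exact (Real.exp_log hx).symm
  have := hc.measurable_piecewise (g := fun _ => (0 : ℝ)) continuousOn_const
    hw.isOpen_support.measurableSet
  convert this using 1
  ext x
  by_cases hx : x ∈ support w
  · simp [hx]
  · simp [hx, eq_zero_of_notMem hw hx]

lemma smul_mem_support (hw : IsHomogeneousLogConcave α w) {t : ℝ} (ht : 0 < t) {x : 𝔼 n}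
    (hx : x ∈ support w) : t • x ∈ support w := by
  change 0 < w (t • x)
  rw [hw.homogeneous t ht x hx]
  exact mul_pos (Real.rpow_pos_of_pos ht _) hx

lemma weight_smul (hw : IsHomogeneousLogConcave α w) {t : ℝ} (ht : 0 < t) (x : 𝔼 n) :
    w (t • x) = t ^ α * w x := by
  by_cases hx : x ∈ support w
  · exact hw.homogeneous t ht x hx
  · have : t • x ∉ support w := fun h => hx <| by
      simpa [smul_smul, ht.ne'] using smul_mem_support hw (inv_pos.2 ht) h
    rw [eq_zero_of_notMem hw hx, eq_zero_of_notMem hw this, mul_zero]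

/-- A log-concave weight grows at most exponentially. -/
lemma weight_le_exp (hw : IsHomogeneousLogConcave α w) :
    ∃ C : ℝ, 0 ≤ C ∧ ∀ x, w x ≤ Real.exp (C * (1 + ‖x‖)) := by
  obtain ⟨x₀, hx₀⟩ := hw.nonempty_support
  obtain ⟨r, hr, hball⟩ := Metric.nhds_basis_closedBall.mem_iff.1 (hw.isOpen_support.mem_nhds hx₀)
  have hcont := (hw.logConcave.continuousOn hw.isOpen_support).mono hball
  obtain ⟨p, hp, hmax⟩ := (isCompact_closedBall x₀ r).exists_isMaxOn
    ⟨x₀, by simp [hr.le]⟩ hcont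
  set L := Real.log (w x₀)
  set M := Real.log (w p)
  have hLM : L ≤ M := hmax (by simp [hr.le] : x₀ ∈ Metric.closedBall x₀ r)
  refine ⟨(M - L) * (1 + ‖x₀‖ / r + 1 / r) + |L|, ?_, fun x => ?_⟩
  · have := sub_nonneg.2 hLM
    positivity
  by_cases hx : x ∈ support w
  swap
  · rw [eq_zero_of_notMem hw hx]; positivity
  rw [← Real.log_le_iff_le_exp hx]
  set d := ‖x - x₀‖
  have hd : 0 ≤ d := norm_nonneg _
  have hrd : 0 < r + d := by positivity
  have ha : 0 ≤ d / (r + d) := by positivity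
  have hb : 0 ≤ r / (r + d) := by positivity
  -- These weights place the convex combination of `x₀` and `x` in the ball of radius `r`, where
  -- `log w ≤ M`. Concavity then bounds `log (w x)` by an affine function of `d`.
  have hconc := hw.logConcave.2 hx₀ hx ha hb (by field_simp; ring)
  have hmem : (d / (r + d)) • x₀ + (r / (r + d)) • x ∈ Metric.closedBall x₀ r := by
    have e : (d / (r + d)) • x₀ + (r / (r + d)) • x - x₀ = (r / (r + d)) • (x - x₀) := by
      have : d / (r + d) = 1 - r / (r + d) := by field_simp; ring
      rw [this]; module
    rw [mem_closedBall_iff_norm, e, norm_smul, Real.norm_of_nonneg (by positivity),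
      div_mul_eq_mul_div, div_le_iff₀ hrd]
    change r * d ≤ _
    nlinarith
  have hle := hconc.trans (hmax hmem)
  simp only [smul_eq_mul] at hle
  change d / (r + d) * L + r / (r + d) * Real.log (w x) ≤ M at hle
  have h1 : d * L + r * Real.log (w x) ≤ M * (r + d) := by
    have := mul_le_mul_of_nonneg_right hle hrd.le
    have e : (d / (r + d) * L + r / (r + d) * Real.log (w x)) * (r + d)
        = d * L + r * Real.log (w x) := by field_simp
    linarith
  have h2 : Real.log (w x) ≤ (M - L) * (1 + d / r) + L := by
    have e : (M - L) * (1 + d / r) + L = (M * (r + d) - d * L) / r := by field_simp; ring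
    rw [e, le_div_iff₀ hr]; linarith
  have h3 : d ≤ ‖x‖ + ‖x₀‖ := norm_sub_le _ _
  have h4 : (M - L) * (1 + d / r) ≤ (M - L) * (1 + ‖x₀‖ / r + ‖x‖ / r) := by
    refine mul_le_mul_of_nonneg_left ?_ (sub_nonneg.2 hLM)
    have := div_le_div_of_nonneg_right h3 hr.le
    rw [add_div] at this
    linarith
  have h5 : 0 ≤ (M - L) * (1 / r) := mul_nonneg (sub_nonneg.2 hLM) (by positivity)
  have h6 : 0 ≤ ((M - L) * (1 + ‖x₀‖ / r)) * ‖x‖ :=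
    mul_nonneg (mul_nonneg (sub_nonneg.2 hLM) (by positivity)) (norm_nonneg _)
  have h7 : 0 ≤ |L| * ‖x‖ := by positivity
  have h8 : (M - L) * (1 + ‖x₀‖ / r + ‖x‖ / r)
    = (M - L) * (1 + ‖x₀‖ / r) + (M - L) * (1 / r) * ‖x‖ := by ring
  have := le_abs_self L
  nlinarith

lemma nu_eq (hw : IsHomogeneousLogConcave α w) :
    nu w = volume.withDensity (fun x => ENNReal.ofReal (w x)) := by
  rw [nu, ← withDensity_indicator hw.isOpen_support.measurableSet]
  congr 1
  ext x
  by_cases hx : x ∈ support w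
  · simp [hx]
  · simp [hx, eq_zero_of_notMem hw hx]

lemma lintegral_nu (hw : IsHomogeneousLogConcave α w) (φ : (𝔼 n) → ℝ≥0∞) :
    ∫⁻ x, φ x ∂(nu w) = ∫⁻ x, ENNReal.ofReal (w x) * φ x := by
  rw [nu_eq hw, lintegral_withDensity_eq_lintegral_mul_non_measurable _
    (measurable_weight hw).ennreal_ofReal (by simp)]
  rfl

lemma integral_nu (hw : IsHomogeneousLogConcave α w) (φ : (𝔼 n) → ℝ) :
    ∫ x, φ x ∂(nu w) = ∫ x, w x * φ x := by
  rw [nu_eq hw, integral_withDensity_eq_integral_toReal_smul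
    (measurable_weight hw).ennreal_ofReal (by simp)]
  simp [ENNReal.toReal_ofReal (hw.nonneg _)]

lemma integrable_nu_iff (hw : IsHomogeneousLogConcave α w) {φ : (𝔼 n) → ℝ} :
    Integrable φ (nu w) ↔ Integrable (fun x => w x * φ x) := by
  rw [nu_eq hw, integrable_withDensity_iff_integrable_smul'
    (measurable_weight hw).ennreal_ofReal (by simp)]
  simp [ENNReal.toReal_ofReal (hw.nonneg _)]

lemma integrable_nu_exp_neg (hw : IsHomogeneousLogConcave α w) {c : ℝ} (hc : 0 < c) :
    Integrable (fun x => Real.exp (-c * ‖x‖ ^ 2)) (nu w) := by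
  rw [integrable_nu_iff hw]
  obtain ⟨C, hC, hle⟩ := weight_le_exp hw
  refine ((integrable_exp_neg_mul_sq_norm (n := n) (half_pos hc)).const_mul
    (Real.exp (C + C ^ 2 / (2 * c)))).mono'
    ((measurable_weight hw).mul (by fun_prop)).aestronglyMeasurable (ae_of_all _ fun x => ?_)
  rw [Real.norm_of_nonneg (mul_nonneg (hw.nonneg x) (Real.exp_nonneg _))]
  refine (mul_le_mul_of_nonneg_right (hle x) (Real.exp_nonneg _)).trans ?_
  rw [← Real.exp_add, ← Real.exp_add, Real.exp_le_exp]
  -- Half of the Gaussian decay absorbs the linear exponent of `w`; completing the square yields the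
  -- constant `C + C² / (2c)`.
  have e : C + C ^ 2 / (2 * c) + -(c / 2) * ‖x‖ ^ 2 - (C * (1 + ‖x‖) + -c * ‖x‖ ^ 2)
    = (C - c * ‖x‖) ^ 2 / (2 * c) := by field_simp; ring
  have : 0 ≤ (C - c * ‖x‖) ^ 2 / (2 * c) := by positivity
  linarith

lemma integrable_nu_of_le (hw : IsHomogeneousLogConcave α w) {F : Type*} [NormedAddCommGroup F]
    {φ : (𝔼 n) → F} (hφ : AEStronglyMeasurable φ (nu w)) {K c : ℝ} (hc : 0 < c)
    (h : ∀ x, ‖φ x‖ ≤ K * Real.exp (-c * ‖x‖ ^ 2)) : Integrable φ (nu w) :=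
  ((integrable_nu_exp_neg hw hc).const_mul K).mono' hφ (ae_of_all _ h)

lemma isFiniteMeasureOnCompacts_nu (hw : IsHomogeneousLogConcave α w) :
    IsFiniteMeasureOnCompacts (nu w) := by
  refine ⟨fun K hK => ?_⟩
  obtain ⟨R, hR⟩ := hK.isBounded.exists_norm_le
  have hR' : ∀ x ∈ K, ‖x‖ ^ 2 ≤ R ^ 2 := fun x hx =>
    pow_le_pow_left₀ (norm_nonneg _) (hR x hx) 2
  have hint := integrable_nu_of_le hw (φ := K.indicator fun _ => (1 : ℝ)) (c := 1)
    (K := Real.exp (R ^ 2))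
    ((measurable_const.indicator hK.measurableSet).aestronglyMeasurable) one_pos fun x => by
      rw [← Real.exp_add]
      by_cases hx : x ∈ K
      · simp only [hx, Set.indicator_of_mem, norm_one, Real.one_le_exp_iff]
        linarith [hR' x hx]
      · simp only [hx, not_false_eq_true, Set.indicator_of_notMem, norm_zero]; positivity
  rw [integrable_indicator_iff hK.measurableSet] at hint
  have := (integrable_const_iff (μ := (nu w).restrict K) (c := (1 : ℝ))).1 hint
  simpa [isFiniteMeasure_iff] using this

/-- The total mass of the weighted Gaussian. -/
lemma normConst_eq (hw : IsHomogeneousLogConcave α w) :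
    normConst w = (∫ x, Real.exp (-‖x‖ ^ 2 / 2) ∂(nu w))⁻¹ := by
  rw [normConst, integral_nu hw, ← integral_indicator hw.isOpen_support.measurableSet]
  congr 2
  ext x
  by_cases hx : x ∈ support w
  · simp [hx]
  · simp [hx, eq_zero_of_notMem hw hx]

lemma integrable_nu_gauss (hw : IsHomogeneousLogConcave α w) :
    Integrable (fun x => Real.exp (-‖x‖ ^ 2 / 2)) (nu w) := by
  convert integrable_nu_exp_neg hw (half_pos one_pos) using 3
  ring

lemma nu_ne_zero (hw : IsHomogeneousLogConcave α w) : nu w ≠ 0 := by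
  intro h
  have h1 : nu w (support w) = 0 := by simp [h]
  rw [nu_eq hw, withDensity_apply _ hw.isOpen_support.measurableSet,
    lintegral_eq_zero_iff (measurable_weight hw).ennreal_ofReal] at h1
  have h2 : ∀ᵐ x ∂(volume.restrict (support w)), False := by
    filter_upwards [h1, ae_restrict_mem hw.isOpen_support.measurableSet] with x hx hx'
    simp only [Pi.zero_apply, ENNReal.ofReal_eq_zero] at hx
    exact absurd hx' (not_lt.2 hx)
  rw [ae_iff] at h2
  simp only [not_false_eq_true, Set.ofPred_true, Measure.restrict_apply_univ] at h2
  exact hw.isOpen_support.measure_ne_zero _ hw.nonempty_support h2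

lemma integral_nu_gauss_pos (hw : IsHomogeneousLogConcave α w) :
    0 < ∫ x, Real.exp (-‖x‖ ^ 2 / 2) ∂(nu w) := by
  rw [integral_pos_iff_support_of_nonneg (fun x => Real.exp_nonneg _) (integrable_nu_gauss hw)]
  have : Function.support (fun x : 𝔼 n => Real.exp (-‖x‖ ^ 2 / 2)) = Set.univ := by
    ext x; simp [Real.exp_ne_zero]
  rw [this, Measure.measure_univ_pos]
  exact nu_ne_zero hw

lemma normConst_pos (hw : IsHomogeneousLogConcave α w) : 0 < normConst w := by
  rw [normConst_eq hw]
  exact inv_pos.2 (integral_nu_gauss_pos hw)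

lemma mu_eq (hw : IsHomogeneousLogConcave α w) :
    mu w = (nu w).withDensity
      (fun x => ENNReal.ofReal (normConst w * Real.exp (-‖x‖ ^ 2 / 2))) := by
  rw [mu, nu, ← withDensity_mul _ (measurable_weight hw).ennreal_ofReal (by fun_prop)]
  congr 1
  ext x
  rw [Pi.mul_apply, ← ENNReal.ofReal_mul (hw.nonneg x)]
  congr 1
  ring

lemma lintegral_mu (hw : IsHomogeneousLogConcave α w) (φ : (𝔼 n) → ℝ≥0∞) :
    ∫⁻ x, φ x ∂(mu w) =
      ∫⁻ x, ENNReal.ofReal (normConst w * Real.exp (-‖x‖ ^ 2 / 2)) * φ x ∂(nu w) := by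
  rw [mu_eq hw, lintegral_withDensity_eq_lintegral_mul_non_measurable _ (by fun_prop) (by simp)]
  rfl

lemma integral_mu (hw : IsHomogeneousLogConcave α w) (φ : (𝔼 n) → ℝ) :
    ∫ x, φ x ∂(mu w) = normConst w * ∫ x, Real.exp (-‖x‖ ^ 2 / 2) * φ x ∂(nu w) := by
  rw [mu_eq hw, integral_withDensity_eq_integral_toReal_smul (by fun_prop) (by simp),
    ← integral_const_mul]
  congr 1
  ext x
  rw [ENNReal.toReal_ofReal (mul_nonneg (normConst_pos hw).le (Real.exp_nonneg _)), smul_eq_mul,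
    mul_assoc]

lemma isProbabilityMeasure_mu (hw : IsHomogeneousLogConcave α w) :
    IsProbabilityMeasure (mu w) := by
  refine ⟨?_⟩
  rw [← lintegral_one, lintegral_mu hw]
  simp only [mul_one]
  rw [← ofReal_integral_eq_lintegral_ofReal ((integrable_nu_gauss hw).const_mul _)
    (ae_of_all _ fun x => mul_nonneg (normConst_pos hw).le (Real.exp_nonneg _)),
    integral_const_mul, normConst_eq hw, inv_mul_cancel₀ (integral_nu_gauss_pos hw).ne',
    ENNReal.ofReal_one]

/-- Lebesgue measure contributes `t ^ (-n)` and the homogeneity of `w` contributes `t ^ (-α)`. -/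
lemma integral_comp_smul_nu (hw : IsHomogeneousLogConcave α w) (φ : (𝔼 n) → ℝ) {t : ℝ}
    (ht : 0 < t) : ∫ x, φ (t • x) ∂(nu w) = t ^ (-(n + α)) * ∫ x, φ x ∂(nu w) := by
  rw [integral_nu hw, integral_nu hw]
  have h := Measure.integral_comp_smul (volume : Measure (𝔼 n)) (fun x => w x * φ x) t
  have e : ∀ x : 𝔼 n, w x * φ (t • x) = t ^ (-α) * (w (t • x) * φ (t • x)) := fun x => by
    rw [weight_smul hw ht, ← mul_assoc, ← mul_assoc, ← Real.rpow_add ht]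
    simp
  simp_rw [e]
  rw [integral_const_mul, h, finrank_euclideanSpace_fin, abs_of_pos (by positivity), smul_eq_mul,
    ← mul_assoc, neg_add, Real.rpow_add ht, Real.rpow_neg ht.le, Real.rpow_neg ht.le,
    Real.rpow_natCast, mul_comm (t ^ n)⁻¹]

/-- Euler's identity for the homogeneous measure `ν`. -/
lemma integral_fderiv_apply_self (hw : IsHomogeneousLogConcave α w) {φ : (𝔼 n) → ℝ}
    (hφ : ContDiff ℝ 1 φ) (hφi : Integrable φ (nu w)) {b : (𝔼 n) → ℝ} (hb : Integrable b (nu w))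
    (hle : ∀ x, ∀ t ∈ Metric.ball (1 : ℝ) (1 / 2), |fderiv ℝ φ (t • x) x| ≤ b x) :
    ∫ x, fderiv ℝ φ x x ∂(nu w) = -(n + α) * ∫ x, φ x ∂(nu w) := by
  have hd : ∀ x t, HasDerivAt (fun t : ℝ => φ (t • x)) (fderiv ℝ φ (t • x) x) t := fun x t => by
    have h1 := (hφ.differentiable (by simp) (t • x)).hasFDerivAt
    have h2 : HasDerivAt (fun t : ℝ => t • x) x t := by
      simpa using (hasDerivAt_id t).smul_const x
    exact h1.comp_hasDerivAt t h2
  have hcf := hφ.continuous_fderiv (by simp)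
  -- The function `t ↦ ∫ φ(t x) dν` is differentiated at `t = 1` in two ways: under the integral,
  -- and through the scaling law. Dilations preserve the cone, so no boundary term appears.
  obtain ⟨-, h⟩ := hasDerivAt_integral_of_dominated_loc_of_deriv_le (μ := nu w)
    (F := fun (t : ℝ) x => φ (t • x)) (F' := fun t x => fderiv ℝ φ (t • x) x) (x₀ := 1)
    (Metric.ball_mem_nhds 1 (by norm_num : (0 : ℝ) < 1 / 2))
    (Eventually.of_forall fun t => (hφ.continuous.comp (by fun_prop)).aestronglyMeasurable)
    (by simpa using hφi)
    (by
      have : Continuous fun x => fderiv ℝ φ ((1 : ℝ) • x) x :=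
        (hcf.comp (by fun_prop)).clm_apply continuous_id
      exact this.aestronglyMeasurable)
    (ae_of_all _ fun x t ht => by simpa using hle x t ht) hb (ae_of_all _ fun x t _ => hd x t)
  have h2 : HasDerivAt (fun t : ℝ => t ^ (-(n + α)) * ∫ x, φ x ∂(nu w))
      (-(n + α) * ∫ x, φ x ∂(nu w)) 1 := by
    have := (Real.hasDerivAt_rpow_const (x := 1) (p := -(n + α)) (Or.inl one_ne_zero)).mul_const
      (∫ x, φ x ∂(nu w))
    simpa using this
  have h3 := h.congr_of_eventuallyEq
    (show (fun t : ℝ => t ^ (-(n + α)) * ∫ x, φ x ∂(nu w)) =ᶠ[𝓝 1] _ from by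
      filter_upwards [eventually_gt_nhds (zero_lt_one' ℝ)] with t ht
      exact (integral_comp_smul_nu hw φ ht).symm)
  simpa using h3.unique h2

/-- The Prékopa–Leindler inequality for the weighted Gaussian measure, which is uniformly
log-concave. -/
lemma prekopaLeindler_mu (hw : IsHomogeneousLogConcave α w) {t s : ℝ} (ht : 0 < t) (hs : 0 < s)
    (hts : t + s = 1) {u h : (𝔼 n) → ℝ} (hu : Measurable u) (hh : Measurable h)
    (H : ∀ x y, t * u x - t * s / 2 * ‖x - y‖ ^ 2 ≤ h (t • x + s • y)) :
    (∫⁻ x, ENNReal.ofReal (Real.exp (u x)) ∂(mu w)) ^ t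
      ≤ ∫⁻ x, ENNReal.ofReal (Real.exp (h x)) ∂(mu w) := by
  have hC := normConst_pos hw
  have hprob := isProbabilityMeasure_mu hw
  set ρ : (𝔼 n) → ℝ := fun x => normConst w * Real.exp (-‖x‖ ^ 2 / 2) * w x
  have hρm : Measurable ρ := (by fun_prop : Measurable fun x : 𝔼 n =>
    normConst w * Real.exp (-‖x‖ ^ 2 / 2)).mul (measurable_weight hw)
  have hρ0 : ∀ x, 0 ≤ ρ x := fun x =>
    mul_nonneg (mul_nonneg hC.le (Real.exp_nonneg _)) (hw.nonneg x)
  have e : ∀ φ : (𝔼 n) → ℝ, ∫⁻ x, ENNReal.ofReal (φ x) ∂(mu w)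
      = ∫⁻ x, ENNReal.ofReal (ρ x * φ x) := fun φ => by
    rw [lintegral_mu hw, lintegral_nu hw]
    refine lintegral_congr fun x => ?_
    rw [← mul_assoc, ← ENNReal.ofReal_mul (hw.nonneg x), ← ENNReal.ofReal_mul
      (mul_nonneg (hw.nonneg x) (mul_nonneg hC.le (Real.exp_nonneg _)))]
    congr 1; simp only [ρ]; ring
  have e1 := e fun _ => 1
  simp only [ENNReal.ofReal_one, lintegral_one, measure_univ, mul_one] at e1
  -- The second function is the density `ρ` alone. Its integral is `1`, so its factor disappears.
  have key := PrekopaLeindler.rpow_lintegral_mul_le ht hs hts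
    (hρm.mul (Real.measurable_exp.comp hu)).ennreal_ofReal hρm.ennreal_ofReal
    (hρm.mul (Real.measurable_exp.comp hh)).ennreal_ofReal fun x y => ?_
  · rw [← e1, ENNReal.one_rpow, mul_one] at key
    rw [e, e]
    exact key
  simp only [Function.comp, Pi.mul_apply]
  rw [ENNReal.ofReal_rpow_of_nonneg (mul_nonneg (hρ0 x) (Real.exp_nonneg _)) ht.le,
    ENNReal.ofReal_rpow_of_nonneg (hρ0 y) hs.le,
    ← ENNReal.ofReal_mul (Real.rpow_nonneg (mul_nonneg (hρ0 x) (Real.exp_nonneg _)) _)]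
  refine ENNReal.ofReal_le_ofReal ?_
  by_cases hx : x ∈ support w
  swap
  · simp only [ρ, eq_zero_of_notMem hw hx, mul_zero, zero_mul, Real.zero_rpow ht.ne']
    exact mul_nonneg (hρ0 _) (Real.exp_nonneg _)
  by_cases hy : y ∈ support w
  swap
  · simp only [ρ, eq_zero_of_notMem hw hy, mul_zero, Real.zero_rpow hs.ne']
    exact mul_nonneg (hρ0 _) (Real.exp_nonneg _)
  have hz : t • x + s • y ∈ support w := hw.logConcave.1 hx hy ht.le hs.le hts
  have hconc := hw.logConcave.2 hx hy ht.le hs.le hts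
  simp only [smul_eq_mul] at hconc
  have hpos : ∀ {z}, z ∈ support w →
      ρ z = Real.exp (Real.log (normConst w) - ‖z‖ ^ 2 / 2 + Real.log (w z)) := fun {z} hz => by
    rw [Real.exp_add, Real.exp_log hz, sub_eq_add_neg, Real.exp_add, Real.exp_log hC, ← neg_div]
  rw [hpos hx, hpos hy, hpos hz, ← Real.exp_add, ← Real.exp_add, ← Real.exp_mul, ← Real.exp_mul,
    ← Real.exp_add, Real.exp_le_exp]
  -- The strong convexity of `‖·‖² / 2`, as an identity: the source of the term `t s / 2 ‖x - y‖²`.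
  have hnorm : t * ‖x‖ ^ 2 + s * ‖y‖ ^ 2 - ‖t • x + s • y‖ ^ 2 = t * s * ‖x - y‖ ^ 2 := by
    rw [norm_add_sq_real, norm_sub_sq_real, norm_smul, norm_smul, real_inner_smul_left,
      real_inner_smul_right, Real.norm_of_nonneg ht.le, Real.norm_of_nonneg hs.le]
    have : s = 1 - t := by linarith
    subst this; ring
  have := H x y
  have hl : t * Real.log (normConst w) + s * Real.log (normConst w) = Real.log (normConst w) := by
    rw [← add_mul, hts, one_mul]
  nlinarith

end Weight

/-! ### The logarithmic Sobolev inequality for the weighted Gaussian. -/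

section GaussianLSI

variable {n : ℕ} {α : ℝ} {w : (𝔼 n) → ℝ}

/-- The mean value inequality gives `M` where Taylor's formula would give `M / 2`. Any constant will
do, since its effect vanishes as `d → 0` in `ent_exp_le`. -/
lemma le_taylor_of_lipschitz {g : (𝔼 n) → ℝ} (hg : Differentiable ℝ g) {M : ℝ}
    (hM : ∀ x y, ‖fderiv ℝ g x - fderiv ℝ g y‖ ≤ M * ‖x - y‖) (x z : 𝔼 n) :
    g x ≤ g z + fderiv ℝ g z (x - z) + M * ‖x - z‖ ^ 2 := by
  have h1 : ∀ y ∈ segment ℝ z x, ‖fderiv ℝ g y - fderiv ℝ g z‖ ≤ M * ‖x - z‖ := by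
    intro y hy
    have h0 : 0 ≤ M * ‖x - z‖ := (norm_nonneg _).trans (hM x z)
    rcases eq_or_ne x z with rfl | hne
    · simp only [segment_same, Set.mem_singleton_iff] at hy
      simp [hy]
    · have hM0 : 0 ≤ M := nonneg_of_mul_nonneg_left h0 (norm_pos_iff.2 (sub_ne_zero.2 hne))
      refine (hM y z).trans (mul_le_mul_of_nonneg_left ?_ hM0)
      obtain ⟨θ, ⟨h0, h1⟩, rfl⟩ := (segment_eq_image' ℝ z x ▸ hy)
      simp only [add_sub_cancel_left, norm_smul, Real.norm_of_nonneg h0]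
      exact mul_le_of_le_one_left (norm_nonneg _) h1
  have h2 := (convex_segment z x).norm_image_sub_le_of_norm_hasFDerivWithin_le'
    (fun y _ => (hg y).hasFDerivAt.hasFDerivWithinAt) h1 (left_mem_segment ℝ z x)
    (right_mem_segment ℝ z x)
  have h3 := le_of_abs_le (Real.norm_eq_abs _ ▸ h2)
  nlinarith

lemma integrable_mu_of_bounded (hw : IsHomogeneousLogConcave α w) {φ : (𝔼 n) → ℝ}
    (hφ : Continuous φ) {K : ℝ} (hK : ∀ x, |φ x| ≤ K) : Integrable φ (mu w) := by
  have := isProbabilityMeasure_mu hw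
  exact Integrable.of_bound hφ.aestronglyMeasurable K (ae_of_all _ hK)

/-- The hypercontractive form of the Prékopa–Leindler inequality for a smooth exponent. -/
lemma log_integral_exp_le (hw : IsHomogeneousLogConcave α w) {g : (𝔼 n) → ℝ}
    (hg : ContDiff ℝ 1 g) {B M K : ℝ} (hB : ∀ x, |g x| ≤ B) (hK : ∀ x, ‖fderiv ℝ g x‖ ≤ K)
    (hM : ∀ x y, ‖fderiv ℝ g x - fderiv ℝ g y‖ ≤ M * ‖x - y‖) {d : ℝ} (hd : 0 < d)
    (hMd : 2 * M * d < 1) :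
    Real.log (∫ x, Real.exp ((1 + d) * g x) ∂(mu w)) ≤ (1 + d) * Real.log
      (∫ x, Real.exp (g x + d / (2 * (1 - 2 * M * d)) * ‖fderiv ℝ g x‖ ^ 2) ∂(mu w)) := by
  have hprob := isProbabilityMeasure_mu hw
  have hgc := hg.continuous
  have hDc : Continuous (fderiv ℝ g) := hg.continuous_fderiv (by simp)
  set κ := d / (2 * (1 - 2 * M * d))
  have h1d : 0 < 1 + d := by linarith
  have hq : 0 < 1 - 2 * M * d := by linarith
  have hκ : 0 ≤ κ := by positivity
  -- With weights `1 / (1 + d)` and `d / (1 + d)`, the term `t * u x` is exactly `g x`, and the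
  -- quadratic gain is `‖x - z‖² / (2d)`.
  have hpl := prekopaLeindler_mu hw (t := 1 / (1 + d)) (s := d / (1 + d)) (by positivity)
    (by positivity) (by field_simp) (u := fun x => (1 + d) * g x)
    (h := fun x => g x + κ * ‖fderiv ℝ g x‖ ^ 2) (by fun_prop) (by fun_prop) fun x y => by
      set z := (1 / (1 + d)) • x + (d / (1 + d)) • y
      have hk : x - z = (d / (1 + d)) • (x - y) := by
        have : (1 : ℝ) / (1 + d) = 1 - d / (1 + d) := by field_simp; ring
        simp only [z, this]; module
      have hn : ‖x - z‖ = d / (1 + d) * ‖x - y‖ := by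
        rw [hk, norm_smul, Real.norm_of_nonneg (by positivity)]
      have hn2 : 1 / (1 + d) * (d / (1 + d)) / 2 * ‖x - y‖ ^ 2 = ‖x - z‖ ^ 2 / (2 * d) := by
        rw [hn]; field_simp
      have ht := le_taylor_of_lipschitz (hg.differentiable (by simp)) hM x z
      have ho : fderiv ℝ g z (x - z) ≤ ‖fderiv ℝ g z‖ * ‖x - z‖ :=
        (le_abs_self _).trans ((fderiv ℝ g z).le_opNorm _)
      rw [hn2, ← mul_assoc, one_div_mul_cancel h1d.ne', one_mul]
      set a := ‖fderiv ℝ g z‖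
      set k := ‖x - z‖
      -- Completing the square in `k`: the maximum of `a k + M k² - k² / (2d)` is `κ a²`. The
      -- condition `2 M d < 1` makes this expression concave in `k`.
      have e' : ∀ q : ℝ, 0 < q → M = (1 - q) / (2 * d) →
          d / (2 * q) * a ^ 2 - (a * k + M * k ^ 2 - k ^ 2 / (2 * d))
            = (d * a - q * k) ^ 2 / (2 * d * q) := by
        rintro q hq rfl; field_simp; ring
      have e := e' _ hq (by field_simp; ring)
      have : 0 ≤ (d * a - (1 - 2 * M * d) * k) ^ 2 / (2 * d * (1 - 2 * M * d)) := by positivity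
      linarith
  have i1 : Integrable (fun x => Real.exp ((1 + d) * g x)) (mu w) :=
    integrable_mu_of_bounded hw (by fun_prop) (K := Real.exp ((1 + d) * B)) fun x => by
      rw [Real.abs_exp, Real.exp_le_exp]
      exact mul_le_mul_of_nonneg_left ((le_abs_self _).trans (hB x)) h1d.le
  have i2 : Integrable (fun x => Real.exp (g x + κ * ‖fderiv ℝ g x‖ ^ 2)) (mu w) :=
    integrable_mu_of_bounded hw (by fun_prop) (K := Real.exp (B + κ * K ^ 2)) fun x => by
      rw [Real.abs_exp, Real.exp_le_exp]
      exact add_le_add ((le_abs_self _).trans (hB x))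
        (mul_le_mul_of_nonneg_left (pow_le_pow_left₀ (norm_nonneg _) (hK x) 2) hκ)
  rw [← ofReal_integral_eq_lintegral_ofReal i1 (ae_of_all _ fun x => Real.exp_nonneg _),
    ← ofReal_integral_eq_lintegral_ofReal i2 (ae_of_all _ fun x => Real.exp_nonneg _),
    ENNReal.ofReal_rpow_of_nonneg (integral_nonneg fun x => Real.exp_nonneg _) (by positivity),
    ENNReal.ofReal_le_ofReal_iff (integral_nonneg fun x => Real.exp_nonneg _)] at hpl
  have p1 := integral_exp_pos i1
  have := Real.log_le_log (by positivity) hpl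
  rw [Real.log_rpow p1, one_div, inv_mul_le_iff₀ h1d] at this
  exact this

/-- The logarithmic Sobolev inequality for `μ_w`, for densities `e^g`. -/
lemma ent_exp_le (hw : IsHomogeneousLogConcave α w) {g : (𝔼 n) → ℝ}
    (hg : ContDiff ℝ 1 g) {B M K : ℝ} (hB : ∀ x, |g x| ≤ B) (hK : ∀ x, ‖fderiv ℝ g x‖ ≤ K)
    (hM : ∀ x y, ‖fderiv ℝ g x - fderiv ℝ g y‖ ≤ M * ‖x - y‖) :
    ∫ x, g x * Real.exp (g x) ∂(mu w) -
      (∫ x, Real.exp (g x) ∂(mu w)) * Real.log (∫ x, Real.exp (g x) ∂(mu w))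
      ≤ (1 / 2) * ∫ x, ‖fderiv ℝ g x‖ ^ 2 * Real.exp (g x) ∂(mu w) := by
  have hprob := isProbabilityMeasure_mu hw
  have hgc := hg.continuous
  have hDc : Continuous (fderiv ℝ g) := hg.continuous_fderiv (by simp)
  have hK0 : 0 ≤ K := (norm_nonneg _).trans (hK 0)
  have hB0 : 0 ≤ B := (abs_nonneg _).trans (hB 0)
  have hexp : ∀ x, Real.exp (g x) ≤ Real.exp B := fun x =>
    Real.exp_le_exp.2 ((le_abs_self _).trans (hB x))
  have hgrad : ∀ x (k : ℕ), ‖fderiv ℝ g x‖ ^ k ≤ K ^ k := fun x k =>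
    pow_le_pow_left₀ (norm_nonneg _) (hK x) k
  have iA : Integrable (fun x => Real.exp (g x)) (mu w) :=
    integrable_mu_of_bounded hw (by fun_prop) (K := Real.exp B) fun x => by
      rw [Real.abs_exp]; exact hexp x
  have iE : Integrable (fun x => g x * Real.exp (g x)) (mu w) :=
    integrable_mu_of_bounded hw (by fun_prop) (K := B * Real.exp B) fun x => by
      rw [abs_mul, Real.abs_exp]; exact mul_le_mul (hB x) (hexp x) (Real.exp_nonneg _) hB0
  have iJ : ∀ k : ℕ, Integrable (fun x => ‖fderiv ℝ g x‖ ^ k * Real.exp (g x)) (mu w) := fun k =>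
    integrable_mu_of_bounded hw (by fun_prop) (K := K ^ k * Real.exp B) fun x => by
      rw [abs_mul, Real.abs_exp, abs_of_nonneg (by positivity)]
      exact mul_le_mul (hgrad x k) (hexp x) (Real.exp_nonneg _) (by positivity)
  set A := ∫ x, Real.exp (g x) ∂(mu w)
  set E := ∫ x, g x * Real.exp (g x) ∂(mu w)
  set J := ∫ x, ‖fderiv ℝ g x‖ ^ 2 * Real.exp (g x) ∂(mu w)
  set Q := ∫ x, ‖fderiv ℝ g x‖ ^ 4 * Real.exp (g x) ∂(mu w)
  have hA : 0 < A := integral_exp_pos iA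
  set κ : ℝ → ℝ := fun d => d / (2 * (1 - 2 * M * d))
  have hκ' : HasDerivAt κ (1 / 2) 0 := by
    have h1 : HasDerivAt (fun d : ℝ => 2 * (1 - 2 * M * d)) (2 * (0 - 2 * M * 1)) 0 :=
      ((hasDerivAt_const _ _).sub ((hasDerivAt_id' _).const_mul _)).const_mul 2
    exact ((hasDerivAt_id' (0 : ℝ)).div h1 (by norm_num)).congr_deriv (by norm_num)
  -- A differentiable upper bound, in `d`, for the gap in the hypercontractive inequality, obtained
  -- from `1 + y ≤ e^y` on one side and `e^y ≤ 1 + y + y²` for `0 ≤ y ≤ 1` on the other. As `ψ 0 =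
  -- 0` and `ψ ≥ 0` for small `d > 0`, its derivative at `0` is nonnegative, which is the claim
  -- divided by `A`. The constant `1/2` is `κ'(0)`.
  set ψ : ℝ → ℝ := fun d => (1 + d) * Real.log (A + κ d * J + κ d ^ 2 * Q) - Real.log (A + d * E)
  have hκ0 : κ 0 = 0 := by simp [κ]
  have hψ0 : ψ 0 = 0 := by simp [ψ, hκ0]
  have hψ' : HasDerivAt ψ (Real.log A + J / 2 / A - E / A) 0 := by
    have h1 : HasDerivAt (fun d => A + κ d * J + κ d ^ 2 * Q) (J / 2) 0 := by
      refine (((hκ'.mul_const J).const_add A).add ((hκ'.pow 2).mul_const Q)).congr_deriv ?_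
      simp [hκ0]; ring
    have h2 : HasDerivAt (fun d => A + d * E) E 0 := by
      simpa using ((hasDerivAt_id' (0 : ℝ)).mul_const E).const_add A
    have h3 := (((hasDerivAt_id' (0 : ℝ)).const_add 1).mul
      (h1.log (by simpa [hκ0] using hA.ne'))).sub (h2.log (by simpa using hA.ne'))
    exact h3.congr_deriv (by simp [hκ0])
  have hev : ∀ᶠ d in 𝓝[>] (0 : ℝ), 0 ≤ ψ d := by
    have c1 : ContinuousAt (fun d => 2 * M * d) 0 := by fun_prop
    have c2 : ContinuousAt (fun d => κ d * K ^ 2) 0 := hκ'.continuousAt.mul continuousAt_const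
    have c3 : ContinuousAt (fun d => A + d * E) 0 := by fun_prop
    have e1 := c1.eventually_lt_const (u := 1) (by simp)
    have e2 := c2.eventually_lt_const (u := 1) (by simp [hκ0])
    have e3 := c3.eventually_const_lt (u := 0) (by simpa using hA)
    filter_upwards [self_mem_nhdsWithin, nhdsWithin_le_nhds e1, nhdsWithin_le_nhds e2,
      nhdsWithin_le_nhds e3] with d (hd : 0 < d) h1 h2 h3
    have h1d : 0 < 1 + d := by linarith
    have hκn : 0 ≤ κ d := div_nonneg hd.le (by linarith)
    have main := log_integral_exp_le hw hg hB hK hM hd h1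
    have lower : A + d * E ≤ ∫ x, Real.exp ((1 + d) * g x) ∂(mu w) := by
      rw [← integral_const_mul, ← integral_add iA (iE.const_mul d)]
      refine integral_mono (iA.add (iE.const_mul d))
        (integrable_mu_of_bounded hw (by fun_prop) (K := Real.exp ((1 + d) * B)) fun x => ?_)
        fun x => ?_
      · rw [Real.abs_exp, Real.exp_le_exp]
        exact mul_le_mul_of_nonneg_left ((le_abs_self _).trans (hB x)) h1d.le
      · have h := Real.add_one_le_exp (d * g x)
        have e : Real.exp ((1 + d) * g x) = Real.exp (g x) * Real.exp (d * g x) := by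
          rw [← Real.exp_add]; ring_nf
        simp only [e]
        nlinarith [Real.exp_pos (g x)]
    have upper : ∫ x, Real.exp (g x + κ d * ‖fderiv ℝ g x‖ ^ 2) ∂(mu w)
        ≤ A + κ d * J + κ d ^ 2 * Q := by
      have iAJ : Integrable (fun x => Real.exp (g x) +
        κ d * (‖fderiv ℝ g x‖ ^ 2 * Real.exp (g x))) (mu w) := iA.add ((iJ 2).const_mul _)
      rw [← integral_const_mul, ← integral_const_mul, ← integral_add iA ((iJ 2).const_mul _),
        ← integral_add iAJ ((iJ 4).const_mul _)]
      refine integral_mono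
        (integrable_mu_of_bounded hw (by fun_prop) (K := Real.exp (B + κ d * K ^ 2)) fun x => ?_)
        (iAJ.add ((iJ 4).const_mul _)) fun x => ?_
      · rw [Real.abs_exp, Real.exp_le_exp]
        exact add_le_add ((le_abs_self _).trans (hB x))
          (mul_le_mul_of_nonneg_left (hgrad x 2) hκn)
      · set y := κ d * ‖fderiv ℝ g x‖ ^ 2 with hy
        have hy0 : 0 ≤ y := by positivity
        have hy1 : y ≤ 1 := (mul_le_mul_of_nonneg_left (hgrad x 2) hκn).trans h2.le
        have h := le_of_abs_le (Real.abs_exp_sub_one_sub_id_le (abs_le.2 ⟨by linarith, hy1⟩))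
        have hy2 : κ d ^ 2 * ‖fderiv ℝ g x‖ ^ 4 = y ^ 2 := by rw [hy]; ring
        simp only [Real.exp_add, ← mul_assoc, hy2, ← hy]
        nlinarith [Real.exp_pos (g x)]
    have l1 := Real.log_le_log h3 lower
    have i2 : Integrable (fun x => Real.exp (g x + κ d * ‖fderiv ℝ g x‖ ^ 2)) (mu w) :=
      integrable_mu_of_bounded hw (by fun_prop) (K := Real.exp (B + κ d * K ^ 2)) fun x => by
        rw [Real.abs_exp, Real.exp_le_exp]
        exact add_le_add ((le_abs_self _).trans (hB x))
          (mul_le_mul_of_nonneg_left (hgrad x 2) hκn)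
    have l2 := mul_le_mul_of_nonneg_left (Real.log_le_log (integral_exp_pos i2) upper) h1d.le
    exact sub_nonneg.2 (l1.trans (main.trans l2))
  have hlim := (hasDerivAt_iff_tendsto_slope.1 hψ').mono_left
    (nhdsWithin_mono 0 (show Set.Ioi (0 : ℝ) ⊆ {0}ᶜ from fun d hd => ne_of_gt hd))
  have hnn : 0 ≤ Real.log A + J / 2 / A - E / A := by
    refine ge_of_tendsto hlim ?_
    filter_upwards [hev, self_mem_nhdsWithin] with d hd (hd0 : 0 < d)
    rw [slope_def_field, hψ0, sub_zero, sub_zero]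
    exact div_nonneg hd hd0.le
  have := mul_nonneg hnn hA.le
  have e : (Real.log A + J / 2 / A - E / A) * A = A * Real.log A + J / 2 - E := by
    field_simp
  linarith

/-- The logarithmic Sobolev inequality for `μ_w`, for smooth compactly supported functions. -/
lemma ent_sq_mu_le (hw : IsHomogeneousLogConcave α w) {F : (𝔼 n) → ℝ}
    (hF : ContDiff ℝ 2 F) (hFc : HasCompactSupport F) :
    ∫ x, F x ^ 2 * Real.log (F x ^ 2) ∂(mu w) -
      (∫ x, F x ^ 2 ∂(mu w)) * Real.log (∫ x, F x ^ 2 ∂(mu w))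
      ≤ 2 * ∫ x, ‖fderiv ℝ F x‖ ^ 2 ∂(mu w) := by
  have hprob := isProbabilityMeasure_mu hw
  have hFcont := hF.continuous
  have hDc : Continuous (fderiv ℝ F) := hF.continuous_fderiv (by simp)
  obtain ⟨N, hN⟩ := hFc.exists_bound_of_continuous hFcont
  obtain ⟨N', hN'⟩ := (hFc.fderiv ℝ).exists_bound_of_continuous hDc
  have hN2 : ∀ x, F x ^ 2 ≤ N ^ 2 := fun x => by
    have := pow_le_pow_left₀ (norm_nonneg _) (hN x) 2
    simpa using this
  have iF : Integrable (fun x => F x ^ 2) (mu w) :=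
    integrable_mu_of_bounded hw (by fun_prop) (K := N ^ 2) fun x => by
      rw [abs_of_nonneg (sq_nonneg _)]; exact hN2 x
  have iD : Integrable (fun x => ‖fderiv ℝ F x‖ ^ 2) (mu w) :=
    integrable_mu_of_bounded hw (by fun_prop) (K := N' ^ 2) fun x => by
      rw [abs_of_nonneg (sq_nonneg _)]; exact pow_le_pow_left₀ (norm_nonneg _) (hN' x) 2
  -- `F` may vanish, so the exponential form is applied to `log (F² + ε)`, and then `ε → 0`.
  have perturbed : ∀ ε : ℝ, 0 < ε → ∫ x, (F x ^ 2 + ε) * Real.log (F x ^ 2 + ε) ∂(mu w) -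
      (∫ x, F x ^ 2 ∂(mu w) + ε) * Real.log (∫ x, F x ^ 2 ∂(mu w) + ε)
      ≤ 2 * ∫ x, ‖fderiv ℝ F x‖ ^ 2 ∂(mu w) := by
    intro ε hε
    have hpos : ∀ x, 0 < F x ^ 2 + ε := fun x => by positivity
    set g : (𝔼 n) → ℝ := fun x => Real.log (F x ^ 2 + ε)
    have hg : ContDiff ℝ 2 g := ((hF.pow 2).add contDiff_const).log fun x => (hpos x).ne'
    have hgd : ContDiff ℝ 1 (fderiv ℝ g) := hg.fderiv_right (by norm_num)
    -- Off the support of `F`, `g` is the constant `log ε`. Subtracting it gives compact support,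
    -- hence the bounds on `g`, on its derivative and on the Lipschitz constant of the derivative.
    have hcs : HasCompactSupport fun x => g x - Real.log ε :=
      hFc.comp_left (g := fun r : ℝ => Real.log (r ^ 2 + ε) - Real.log ε) (by simp)
    have hfd : fderiv ℝ (fun x => g x - Real.log ε) = fderiv ℝ g := by
      ext1 x; rw [fderiv_sub_const]
    have hgdc : HasCompactSupport (fderiv ℝ g) := hfd ▸ hcs.fderiv ℝ
    obtain ⟨B, hB⟩ := hcs.exists_bound_of_continuous (hg.continuous.sub continuous_const)
    obtain ⟨K, hK⟩ := hgdc.exists_bound_of_continuous hgd.continuous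
    obtain ⟨M, hM⟩ := hgd.lipschitzWith_of_hasCompactSupport hgdc one_ne_zero
    have key := ent_exp_le hw (hg.of_le (by norm_num)) (B := B + |Real.log ε|) (fun x => by
        have h1 := hB x
        have h2 := abs_add_le (g x - Real.log ε) (Real.log ε)
        rw [sub_add_cancel] at h2
        rw [Real.norm_eq_abs] at h1
        linarith) hK (fun x y => hM.norm_sub_le x y)
    have eg : ∀ x, Real.exp (g x) = F x ^ 2 + ε := fun x => Real.exp_log (hpos x)
    simp only [eg] at key
    have e1 : ∫ x, F x ^ 2 + ε ∂(mu w) = ∫ x, F x ^ 2 ∂(mu w) + ε := by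
      rw [integral_add iF (integrable_const _)]; simp
    rw [e1] at key
    simp_rw [mul_comm (F _ ^ 2 + ε)]
    refine key.trans ?_
    have hle : ∫ x, ‖fderiv ℝ g x‖ ^ 2 * (F x ^ 2 + ε) ∂(mu w)
        ≤ ∫ x, 4 * ‖fderiv ℝ F x‖ ^ 2 ∂(mu w) := by
      refine integral_mono_of_nonneg (ae_of_all _ fun x => ?_) (iD.const_mul 4)
        (ae_of_all _ fun x => ?_)
      · exact mul_nonneg (sq_nonneg _) (hpos x).le
      · have h1 : HasFDerivAt g ((F x ^ 2 + ε)⁻¹ • ((2 * F x) • fderiv ℝ F x)) x := by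
          have := (((hF.differentiable (by simp) x).hasFDerivAt.pow 2).add_const ε).log (hpos x).ne'
          simpa using this
        simp only
        rw [h1.fderiv, norm_smul, norm_smul, Real.norm_of_nonneg (inv_nonneg.2 (hpos x).le),
          Real.norm_eq_abs, mul_pow, mul_pow, sq_abs]
        have hp := hpos x
        have : ((F x ^ 2 + ε)⁻¹ ^ 2 * ((2 * F x) ^ 2 * ‖fderiv ℝ F x‖ ^ 2)) * (F x ^ 2 + ε)
          = 4 * ‖fderiv ℝ F x‖ ^ 2 * (F x ^ 2 / (F x ^ 2 + ε)) := by field_simp; ring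
        rw [this]
        refine mul_le_of_le_one_right (by positivity) ?_
        rw [div_le_one hp]; linarith
    rw [integral_const_mul] at hle
    linarith
  have hcont : Continuous fun r : ℝ => r * Real.log r := Real.continuous_mul_log
  obtain ⟨K, hK⟩ := (isCompact_Icc (a := (0 : ℝ)) (b := N ^ 2 + 1)).exists_bound_of_continuousOn
    hcont.continuousOn
  have lim1 : Tendsto (fun ε => ∫ x, (F x ^ 2 + ε) * Real.log (F x ^ 2 + ε) ∂(mu w)) (𝓝[>] 0)
      (𝓝 (∫ x, F x ^ 2 * Real.log (F x ^ 2) ∂(mu w))) := by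
    refine tendsto_integral_filter_of_dominated_convergence (fun _ => K) ?_ ?_
      (integrable_const _) ?_
    · refine Eventually.of_forall fun ε => Continuous.aestronglyMeasurable ?_
      exact hcont.comp (f := fun x => F x ^ 2 + ε) (by fun_prop)
    · filter_upwards [Ioo_mem_nhdsGT (zero_lt_one' ℝ)] with ε hε
      refine ae_of_all _ fun x => hK _ ⟨by have := hε.1; positivity, ?_⟩
      linarith [hN2 x, hε.2]
    · refine ae_of_all _ fun x => ?_
      have : Continuous fun ε : ℝ => (F x ^ 2 + ε) * Real.log (F x ^ 2 + ε) :=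
        hcont.comp (by fun_prop)
      simpa using (this.tendsto 0).mono_left nhdsWithin_le_nhds
  have lim2 : Tendsto (fun ε => (∫ x, F x ^ 2 ∂(mu w) + ε) * Real.log (∫ x, F x ^ 2 ∂(mu w) + ε))
      (𝓝[>] 0) (𝓝 ((∫ x, F x ^ 2 ∂(mu w)) * Real.log (∫ x, F x ^ 2 ∂(mu w)))) := by
    have : Continuous fun ε : ℝ =>
        (∫ x, F x ^ 2 ∂(mu w) + ε) * Real.log (∫ x, F x ^ 2 ∂(mu w) + ε) :=
      hcont.comp (by fun_prop)
    simpa using (this.tendsto 0).mono_left nhdsWithin_le_nhds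
  exact le_of_tendsto (lim1.sub lim2) (by
    filter_upwards [self_mem_nhdsWithin] with ε hε using perturbed ε hε)

end GaussianLSI

/-! ### Calculus rules for gradients. -/

section GradientCalculus

variable {n : ℕ}

lemma hasGradientAt_mul {f g : (𝔼 n) → ℝ} {f' g' x : 𝔼 n} (hf : HasGradientAt f f' x)
    (hg : HasGradientAt g g' x) :
    HasGradientAt (fun x => f x * g x) (f x • g' + g x • f') x := by
  rw [hasGradientAt_iff_hasFDerivAt] at *
  exact (hf.mul hg).congr_fderiv (by simp)

lemma hasGradientAt_comp {f : (𝔼 n) → ℝ} {f' x : 𝔼 n} {ψ : ℝ → ℝ} {c : ℝ}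
    (hψ : HasDerivAt ψ c (f x)) (hf : HasGradientAt f f' x) :
    HasGradientAt (fun x => ψ (f x)) (c • f') x := by
  rw [hasGradientAt_iff_hasFDerivAt] at *
  exact (hψ.comp_hasFDerivAt x hf).congr_fderiv (by simp)

lemma hasGradientAt_comp_norm_sq {ψ : ℝ → ℝ} {c : ℝ} {x : 𝔼 n}
    (hψ : HasDerivAt ψ c (‖x‖ ^ 2)) :
    HasGradientAt (fun x : 𝔼 n => ψ (‖x‖ ^ 2)) ((2 * c) • x) x := by
  have h : HasGradientAt (fun x : 𝔼 n => ‖x‖ ^ 2) ((2 : ℝ) • x) x := by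
    rw [hasGradientAt_iff_hasFDerivAt]
    refine (hasStrictFDerivAt_norm_sq x).hasFDerivAt.congr_fderiv ?_
    ext y
    simp
  have := hasGradientAt_comp hψ h
  rwa [smul_smul, mul_comm c] at this

lemma hasGradientAt_comp_smul {f : (𝔼 n) → ℝ} {t : ℝ} {x : 𝔼 n}
    (hf : DifferentiableAt ℝ f (t • x)) :
    HasGradientAt (fun x => f (t • x)) (t • gradient f (t • x)) x := by
  have h := hf.hasFDerivAt.comp x ((hasFDerivAt_id x).const_smul t)
  rw [hasGradientAt_iff_hasFDerivAt]
  refine h.congr_fderiv ?_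
  ext y
  simp

lemma norm_gradient (f : (𝔼 n) → ℝ) (x : 𝔼 n) : ‖gradient f x‖ = ‖fderiv ℝ f x‖ := by
  simp [gradient]

lemma continuous_gradient {f : (𝔼 n) → ℝ} (hf : ContDiff ℝ 1 f) : Continuous (gradient f) :=
  (InnerProductSpace.toDual ℝ (𝔼 n)).symm.continuous.comp (hf.continuous_fderiv (by simp))

lemma hasCompactSupport_gradient {f : (𝔼 n) → ℝ} (hf : HasCompactSupport f) :
    HasCompactSupport (gradient f) :=
  (hf.fderiv ℝ).comp_left (g := (InnerProductSpace.toDual ℝ (𝔼 n)).symm) (by simp)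

end GradientCalculus

/-! ### The additive inequality for `nu w` on smooth compactly supported functions. -/

section EuclideanLSI

variable {n : ℕ} {α : ℝ} {w : (𝔼 n) → ℝ}

lemma integrable_nu_of_hasCompactSupport (hw : IsHomogeneousLogConcave α w) {φ : (𝔼 n) → ℝ}
    (hφ : Continuous φ) (hc : HasCompactSupport φ) : Integrable φ (nu w) := by
  have := isFiniteMeasureOnCompacts_nu hw
  exact hφ.integrable_of_hasCompactSupport hc

lemma integral_mul_inner_gradient (hw : IsHomogeneousLogConcave α w) {f : (𝔼 n) → ℝ}
    (hf : ContDiff ℝ 1 f) (hfc : HasCompactSupport f) :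
    ∫ x, f x * inner ℝ (gradient f x) x ∂(nu w) = -((n + α) / 2) * ∫ x, f x ^ 2 ∂(nu w) := by
  have hfin := isFiniteMeasureOnCompacts_nu hw
  have h2 : ContDiff ℝ 1 fun x => f x ^ 2 := hf.pow 2
  have h2c : HasCompactSupport fun x => f x ^ 2 := hfc.comp_left (g := fun r : ℝ => r ^ 2) (by simp)
  have hD := h2.continuous_fderiv (by simp)
  obtain ⟨R, hR⟩ := (h2c.fderiv ℝ).isCompact.isBounded.subset_closedBall 0
  obtain ⟨K, hK⟩ := (h2c.fderiv ℝ).exists_bound_of_continuous hD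
  have hK0 : 0 ≤ K := (norm_nonneg _).trans (hK 0)
  -- For `|t - 1| < 1/2`, a point `t • x` of the support has `‖x‖ ≤ 2R`, so this indicator
  -- dominates.
  have hb : Integrable ((Metric.closedBall (0 : 𝔼 n) (2 * R)).indicator
      fun _ => K * (2 * R)) (nu w) := by
    rw [integrable_indicator_iff Metric.isClosed_closedBall.measurableSet]
    exact integrableOn_const (isCompact_closedBall _ _).measure_lt_top.ne
  have key := integral_fderiv_apply_self hw h2
    (integrable_nu_of_hasCompactSupport hw h2.continuous h2c) hb fun x t ht => by
      rw [Metric.mem_ball, Real.dist_eq, abs_lt] at ht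
      by_cases h : t • x ∈ tsupport (fderiv ℝ fun x => f x ^ 2)
      · have h1 := hR h
        rw [mem_closedBall_zero_iff, norm_smul, Real.norm_of_nonneg (by linarith)] at h1
        have h3 : ‖x‖ ≤ 2 * R := by nlinarith [norm_nonneg x]
        rw [Set.indicator_of_mem (by simpa using h3)]
        exact ((fderiv ℝ (fun x => f x ^ 2) (t • x)).le_opNorm x).trans
          (mul_le_mul (hK _) h3 (norm_nonneg _) hK0)
      · rw [image_eq_zero_of_notMem_tsupport h]
        simp only [zero_apply, abs_zero]
        refine Set.indicator_nonneg (fun y hy => ?_) x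
        have : 0 ≤ 2 * R := (norm_nonneg y).trans (by simpa using hy)
        positivity
  have e : ∀ x, fderiv ℝ (fun x => f x ^ 2) x x = 2 * (f x * inner ℝ (gradient f x) x) := by
    intro x
    rw [((hf.differentiable (by simp) x).hasFDerivAt.pow 2).fderiv, inner_gradient_left]
    simp; ring
  simp_rw [e] at key
  rw [integral_const_mul] at key
  linarith

lemma integrable_mul_log_sq (hw : IsHomogeneousLogConcave α w) {f : (𝔼 n) → ℝ}
    (hf : Continuous f) (hfc : HasCompactSupport f) :
    Integrable (fun x => f x ^ 2 * Real.log (f x ^ 2)) (nu w) :=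
  integrable_nu_of_hasCompactSupport hw (Real.continuous_mul_log.comp (hf.pow 2))
    (hfc.comp_left (g := fun r : ℝ => r ^ 2 * Real.log (r ^ 2)) (by simp))

lemma integrable_sq (hw : IsHomogeneousLogConcave α w) {f : (𝔼 n) → ℝ}
    (hf : Continuous f) (hfc : HasCompactSupport f) :
    Integrable (fun x => f x ^ 2) (nu w) :=
  integrable_nu_of_hasCompactSupport hw (hf.pow 2)
    (hfc.comp_left (g := fun r : ℝ => r ^ 2) (by simp))

lemma integrable_norm_gradient_sq (hw : IsHomogeneousLogConcave α w) {f : (𝔼 n) → ℝ}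
    (hf : ContDiff ℝ 1 f) (hfc : HasCompactSupport f) :
    Integrable (fun x => ‖gradient f x‖ ^ 2) (nu w) :=
  integrable_nu_of_hasCompactSupport hw ((continuous_gradient hf).norm.pow 2)
    ((hasCompactSupport_gradient hfc).comp_left (g := fun r : 𝔼 n => ‖r‖ ^ 2) (by simp))

/-- The additive form of the logarithmic Sobolev inequality for `ν`, at unit scale. -/
lemma integral_mul_log_sq_le_unit (hw : IsHomogeneousLogConcave α w) {f : (𝔼 n) → ℝ}
    (hf : ContDiff ℝ 2 f) (hfc : HasCompactSupport f) :
    ∫ x, f x ^ 2 * Real.log (f x ^ 2) ∂(nu w) ≤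
      (∫ x, f x ^ 2 ∂(nu w)) * (Real.log (∫ x, f x ^ 2 ∂(nu w)) + Real.log (normConst w) - (n + α))
        + 2 * ∫ x, ‖gradient f x‖ ^ 2 ∂(nu w) := by
  have hC := normConst_pos hw
  have hf1 : ContDiff ℝ 1 f := hf.of_le (by norm_num)
  have hfcont := hf.continuous
  have hgcont := continuous_gradient hf1
  -- `E²` cancels the Gaussian density, so `(f E)² dμ_w = C_w f² dν`.
  set E : (𝔼 n) → ℝ := fun x => Real.exp (‖x‖ ^ 2 / 4)
  have hE : ContDiff ℝ 2 E := ((contDiff_norm_sq ℝ).div_const 4).exp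
  have hE' : ∀ x, HasGradientAt E ((E x / 2) • x) x := fun x => by
    have h1 : HasDerivAt (fun r : ℝ => Real.exp (r / 4)) (Real.exp (‖x‖ ^ 2 / 4) * (1 / 4))
      (‖x‖ ^ 2) := ((hasDerivAt_id' _).div_const 4).exp
    have h2 := hasGradientAt_comp_norm_sq h1
    convert h2 using 1
    congr 1
    simp only [E]; ring
  have key := ent_sq_mu_le hw (hf.mul hE) hfc.mul_right
  simp only [← norm_gradient] at key
  have hexp : ∀ x : 𝔼 n, Real.exp (-‖x‖ ^ 2 / 2) * (E x * E x) = 1 := fun x => by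
    simp only [E]; rw [← Real.exp_add, ← Real.exp_add, Real.exp_eq_one_iff]; ring
  set m := ∫ x, f x ^ 2 ∂(nu w)
  set D := ∫ x, ‖gradient f x‖ ^ 2 ∂(nu w)
  set I := ∫ x, f x ^ 2 * Real.log (f x ^ 2) ∂(nu w)
  set V := ∫ x, f x ^ 2 * ‖x‖ ^ 2 ∂(nu w)
  have iV : Integrable (fun x => f x ^ 2 * ‖x‖ ^ 2) (nu w) :=
    integrable_nu_of_hasCompactSupport hw (by fun_prop)
      (hfc.comp_left (g := fun r : ℝ => r ^ 2) (by simp)).mul_right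
  have iX : Integrable (fun x => f x * inner ℝ (gradient f x) x) (nu w) :=
    integrable_nu_of_hasCompactSupport hw (by fun_prop) hfc.mul_right
  have e1 : ∫ x, (f x * E x) ^ 2 ∂(mu w) = normConst w * m := by
    rw [integral_mu hw]
    congr 2
    ext x
    linear_combination f x ^ 2 * hexp x
  have e2 : ∫ x, (f x * E x) ^ 2 * Real.log ((f x * E x) ^ 2) ∂(mu w)
      = normConst w * (I + 1 / 2 * V) := by
    rw [integral_mu hw, ← integral_const_mul (1 / 2),
      ← integral_add (integrable_mul_log_sq hw hfcont hfc) (iV.const_mul _)]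
    congr 2
    ext x
    rcases eq_or_ne (f x) 0 with h0 | h0
    · simp [h0]
    · have : Real.log ((f x * E x) ^ 2) = Real.log (f x ^ 2) + ‖x‖ ^ 2 / 2 := by
        rw [mul_pow, Real.log_mul (by positivity) (by positivity), ← Real.exp_nat_mul,
          Real.log_exp]
        push_cast; ring
      rw [this]
      linear_combination f x ^ 2 * (Real.log (f x ^ 2) + ‖x‖ ^ 2 / 2) * hexp x
  have e3 : ∫ x, ‖gradient (fun x => f x * E x) x‖ ^ 2 ∂(mu w)
      = normConst w * (D - (n + α) / 2 * m + 1 / 4 * V) := by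
    have hX := integral_mul_inner_gradient hw hf1 hfc
    have iDX : Integrable (fun x => ‖gradient f x‖ ^ 2 + f x * inner ℝ (gradient f x) x) (nu w) :=
      (integrable_norm_gradient_sq hw hf1 hfc).add iX
    rw [integral_mu hw, sub_eq_add_neg, ← neg_mul, ← hX, ← integral_const_mul (1 / 4),
      ← integral_add (integrable_norm_gradient_sq hw hf1 hfc) iX,
      ← integral_add iDX (iV.const_mul _)]
    congr 2
    ext x
    rw [(hasGradientAt_mul (hf1.differentiable (by simp) x).hasGradientAt (hE' x)).gradient,
      norm_add_sq_real, smul_smul, norm_smul, norm_smul, real_inner_smul_left,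
      real_inner_smul_right, mul_pow, mul_pow, Real.norm_eq_abs, Real.norm_eq_abs, sq_abs, sq_abs,
      real_inner_comm (gradient f x) x]
    linear_combination (f x ^ 2 * ‖x‖ ^ 2 / 4 + f x * inner ℝ (gradient f x) x
      + ‖gradient f x‖ ^ 2) * hexp x
  change ∫ x, (f x * E x) ^ 2 * Real.log ((f x * E x) ^ 2) ∂(mu w) -
    (∫ x, (f x * E x) ^ 2 ∂(mu w)) * Real.log (∫ x, (f x * E x) ^ 2 ∂(mu w)) ≤
    2 * ∫ x, ‖gradient (fun x => f x * E x) x‖ ^ 2 ∂(mu w) at key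
  rw [e1, e2, e3] at key
  have hm : m * Real.log (normConst w * m) = m * (Real.log m + Real.log (normConst w)) := by
    rcases eq_or_ne m 0 with h0 | h0
    · simp [h0]
    · rw [Real.log_mul hC.ne' h0, add_comm]
  -- The second moment `V` has coefficient `1/2` on both sides and drops out; the cross term in the
  -- gradient leaves `-(n + α) m`.
  have : normConst w * (I + 1 / 2 * V - m * Real.log (normConst w * m)) ≤
      normConst w * (2 * (D - (n + α) / 2 * m + 1 / 4 * V)) := by linarith
  have := le_of_mul_le_mul_left this hC
  rw [hm] at this
  linarith

/-- The additive form of the logarithmic Sobolev inequality for `ν`, at scale `t`. -/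
lemma integral_mul_log_sq_le (hw : IsHomogeneousLogConcave α w) {f : (𝔼 n) → ℝ}
    (hf : ContDiff ℝ 2 f) (hfc : HasCompactSupport f) {t : ℝ} (ht : 0 < t) :
    ∫ x, f x ^ 2 * Real.log (f x ^ 2) ∂(nu w) ≤
      (∫ x, f x ^ 2 ∂(nu w)) * (Real.log (∫ x, f x ^ 2 ∂(nu w)) + Real.log (normConst w)
        - (n + α) - (n + α) * Real.log t) + 2 * t ^ 2 * ∫ x, ‖gradient f x‖ ^ 2 ∂(nu w) := by
  -- Under dilation every integral acquires the factor `c = t ^ (-(n + α))` and the gradient term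
  -- also `t²`; the logarithm of the scaled mass produces `-(n + α) log t`.
  have key := integral_mul_log_sq_le_unit hw (f := fun x => f (t • x))
    (hf.comp (contDiff_const_smul t)) (hfc.comp_smul ht.ne')
  have e : ∀ x, ‖gradient (fun x => f (t • x)) x‖ ^ 2 = t ^ 2 * ‖gradient f (t • x)‖ ^ 2 := by
    intro x
    rw [(hasGradientAt_comp_smul (hf.differentiable (by simp) _)).gradient, norm_smul, mul_pow,
      Real.norm_eq_abs, sq_abs]
  simp_rw [e] at key
  rw [integral_const_mul, integral_comp_smul_nu hw (fun x => f x ^ 2 * Real.log (f x ^ 2)) ht,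
    integral_comp_smul_nu hw (fun x => f x ^ 2) ht,
    integral_comp_smul_nu hw (fun x => ‖gradient f x‖ ^ 2) ht] at key
  set m := ∫ x, f x ^ 2 ∂(nu w)
  set D := ∫ x, ‖gradient f x‖ ^ 2 ∂(nu w)
  set c := t ^ (-(n + α))
  have hc : 0 < c := Real.rpow_pos_of_pos ht _
  have hm : m * Real.log (c * m) = m * (Real.log m - (n + α) * Real.log t) := by
    rcases eq_or_ne m 0 with h0 | h0
    · simp [h0]
    · rw [Real.log_mul hc.ne' h0, Real.log_rpow ht]; ring
  refine le_of_mul_le_mul_left (key.trans (le_of_eq ?_)) hc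
  linear_combination c * hm

/-- A smooth truncation which vanishes near the origin and is the identity where `1 ≤ |r|`. -/
def truncation (r : ℝ) : ℝ := r * Real.smoothTransition (4 * r ^ 2 - 1)

lemma contDiff_truncation : ContDiff ℝ 2 truncation :=
  contDiff_id.mul ((Real.smoothTransition.contDiff (n := 2)).comp (by fun_prop))

lemma truncation_of_one_le {r : ℝ} (hr : 1 ≤ r ^ 2) : truncation r = r := by
  rw [truncation, Real.smoothTransition.one_of_one_le (by linarith), mul_one]

lemma truncation_of_le {r : ℝ} (hr : 4 * r ^ 2 ≤ 1) : truncation r = 0 := by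
  rw [truncation, Real.smoothTransition.zero_of_nonpos (by linarith), mul_zero]

lemma truncation_sq_le (r : ℝ) : truncation r ^ 2 ≤ r ^ 2 := by
  rw [truncation, mul_pow]
  exact mul_le_of_le_one_right (sq_nonneg r)
    (pow_le_one₀ (Real.smoothTransition.nonneg _) (Real.smoothTransition.le_one _))

/-- `truncation` differs from the identity by a smooth compactly supported function. -/
lemma exists_abs_deriv_truncation_le : ∃ L, 0 ≤ L ∧ ∀ r, |deriv truncation r| ≤ L := by
  have hc : HasCompactSupport fun r => truncation r - r := by
    refine HasCompactSupport.of_support_subset_isCompact (isCompact_Icc (a := -1) (b := 1))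
      fun r hr => ?_
    by_contra h
    refine hr (sub_eq_zero.2 (truncation_of_one_le ?_))
    rw [Set.mem_Icc, ← abs_le, not_le] at h
    exact (one_lt_sq_iff_one_lt_abs r).2 h |>.le
  have hd : ContDiff ℝ 1 fun r => truncation r - r :=
    (contDiff_truncation.of_le (by norm_num)).sub contDiff_id
  obtain ⟨L, hL⟩ := hc.deriv.exists_bound_of_continuous (hd.continuous_deriv le_rfl)
  refine ⟨L + 1, by linarith [(norm_nonneg _).trans (hL 0)], fun r => ?_⟩
  have h := hL r
  rw [deriv_fun_sub (contDiff_truncation.differentiable (by simp) r) differentiableAt_fun_id,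
    deriv_id'', Real.norm_eq_abs] at h
  have := abs_add_le (deriv truncation r - 1) 1
  rw [sub_add_cancel, abs_one] at this
  linarith

/-- The positive part of `f² log f²` is controlled by the `L²` norms of `f` and its gradient. -/
lemma entPos_sq_le (hw : IsHomogeneousLogConcave α w) :
    ∃ a b : ℝ, ∀ f : (𝔼 n) → ℝ, ContDiff ℝ 2 f → HasCompactSupport f →
      entPos (nu w) (fun x => f x ^ 2) ≤ ENNReal.ofReal ((∫ x, f x ^ 2 ∂(nu w)) ^ 2
        + a * (∫ x, f x ^ 2 ∂(nu w)) + b * ∫ x, ‖gradient f x‖ ^ 2 ∂(nu w)) := by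
  obtain ⟨L, hL0, hL⟩ := exists_abs_deriv_truncation_le
  refine ⟨|Real.log (normConst w) - (n + α)| + 4, 2 * L ^ 2, fun f hf hfc => ?_⟩
  have hf1 : ContDiff ℝ 1 f := hf.of_le (by norm_num)
  set h : (𝔼 n) → ℝ := fun x => truncation (f x)
  have hh : ContDiff ℝ 2 h := contDiff_truncation.comp hf
  have hhc : HasCompactSupport h := hfc.comp_left (g := truncation) (by simp [truncation])
  have i1 := integrable_mul_log_sq hw hh.continuous hhc
  have i2 := (integrable_sq hw hf.continuous hfc).const_mul 4
  -- A bound on the integral of `f² log f²` alone does not control its positive part. The truncation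
  -- keeps `f` where `|f| ≥ 1` and kills it where `|f| ≤ 1/2`; in between the integrand is at least
  -- `-1`, which `4 f² > 1` compensates.
  have hpt : ∀ x, 0 ≤ h x ^ 2 * Real.log (h x ^ 2) + 4 * f x ^ 2 ∧
      f x ^ 2 * Real.log (f x ^ 2) ≤ h x ^ 2 * Real.log (h x ^ 2) + 4 * f x ^ 2 := by
    intro x
    rcases le_or_gt 1 (f x ^ 2) with h1 | h1
    · have e : h x = f x := truncation_of_one_le h1
      rw [e]
      have := mul_nonneg (sq_nonneg (f x)) (Real.log_nonneg h1)
      constructor <;> nlinarith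
    · have hneg : f x ^ 2 * Real.log (f x ^ 2) ≤ 0 :=
        mul_nonpos_of_nonneg_of_nonpos (sq_nonneg _) (Real.log_nonpos (sq_nonneg _) h1.le)
      have hpos : 0 ≤ h x ^ 2 * Real.log (h x ^ 2) + 4 * f x ^ 2 := by
        rcases le_or_gt (4 * f x ^ 2) 1 with h2 | h2
        · rw [show h x = 0 from truncation_of_le h2]
          simp; positivity
        · have := Real.self_sub_one_le_mul_log (sq_nonneg (h x))
          linarith [sq_nonneg (h x)]
      exact ⟨hpos, hneg.trans hpos⟩
  have h1 : entPos (nu w) (fun x => f x ^ 2) ≤ ENNReal.ofReal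
      (∫ x, (h x ^ 2 * Real.log (h x ^ 2) + 4 * f x ^ 2) ∂(nu w)) := by
    have i12 : Integrable (fun x => h x ^ 2 * Real.log (h x ^ 2) + 4 * f x ^ 2) (nu w) := i1.add i2
    rw [ofReal_integral_eq_lintegral_ofReal i12 (ae_of_all _ fun x => (hpt x).1)]
    exact lintegral_mono fun x => ENNReal.ofReal_le_ofReal (hpt x).2
  refine h1.trans (ENNReal.ofReal_le_ofReal ?_)
  rw [integral_add i1 i2, integral_const_mul]
  have key := integral_mul_log_sq_le_unit hw hh hhc
  have m1 : ∫ x, h x ^ 2 ∂(nu w) ≤ ∫ x, f x ^ 2 ∂(nu w) :=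
    integral_mono (integrable_sq hw hh.continuous hhc) (integrable_sq hw hf.continuous hfc)
      fun x => truncation_sq_le _
  have m0 : 0 ≤ ∫ x, h x ^ 2 ∂(nu w) := integral_nonneg fun x => sq_nonneg _
  have d1 : ∫ x, ‖gradient h x‖ ^ 2 ∂(nu w) ≤ L ^ 2 * ∫ x, ‖gradient f x‖ ^ 2 ∂(nu w) := by
    rw [← integral_const_mul]
    refine integral_mono (integrable_norm_gradient_sq hw (hh.of_le (by norm_num)) hhc)
      ((integrable_norm_gradient_sq hw hf1 hfc).const_mul _) fun x => ?_
    have hg := hasGradientAt_comp (contDiff_truncation.differentiable (by simp) (f x)).hasDerivAt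
      (hf1.differentiable (by simp) x).hasGradientAt
    simp only
    rw [hg.gradient, norm_smul, mul_pow]
    exact mul_le_mul_of_nonneg_right (pow_le_pow_left₀ (norm_nonneg _) (hL _) 2) (sq_nonneg _)
  set m := ∫ x, h x ^ 2 ∂(nu w)
  set M := ∫ x, f x ^ 2 ∂(nu w)
  have l1 : m * Real.log m ≤ M ^ 2 := by
    have : Real.log m ≤ m := Real.log_le_self m0
    nlinarith
  have l2 : m * (Real.log (normConst w) - (n + α)) ≤ |Real.log (normConst w) - (n + α)| * M := by
    rw [mul_comm]
    exact mul_le_mul (le_abs_self _) m1 m0 (abs_nonneg _)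
  nlinarith

end EuclideanLSI

/-! ### Two limit principles for integrals. -/

section Limits

lemma lintegral_le_of_tendsto_ae {X : Type*} [MeasurableSpace X] {ν : Measure X}
    {F : ℕ → X → ℝ≥0∞} {G : X → ℝ≥0∞} {c : ℕ → ℝ≥0∞} {C : ℝ≥0∞} (hF : ∀ k, AEMeasurable (F k) ν)
    (hG : ∀ᵐ x ∂ν, Tendsto (fun k => F k x) atTop (𝓝 (G x))) (hc : ∀ k, ∫⁻ x, F k x ∂ν ≤ c k)
    (hC : Tendsto c atTop (𝓝 C)) : ∫⁻ x, G x ∂ν ≤ C := by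
  calc ∫⁻ x, G x ∂ν = ∫⁻ x, liminf (fun k => F k x) atTop ∂ν :=
        lintegral_congr_ae (hG.mono fun x hx => hx.liminf_eq.symm)
    _ ≤ liminf (fun k => ∫⁻ x, F k x ∂ν) atTop := lintegral_liminf_le' hF
    _ ≤ liminf c atTop := liminf_le_liminf (Eventually.of_forall hc)
    _ = C := hC.liminf_eq

lemma tendsto_integral_norm_sq_of_tendsto_eLpNorm {X F : Type*} [MeasurableSpace X]
    [NormedAddCommGroup F] {ν : Measure X} {v : ℕ → X → F} {f : X → F}
    (hv : ∀ k, MemLp (v k) 2 ν) (hf : MemLp f 2 ν)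
    (h : Tendsto (fun k => eLpNorm (fun x => v k x - f x) 2 ν) atTop (𝓝 0)) :
    Tendsto (fun k => ∫ x, ‖v k x‖ ^ 2 ∂ν) atTop (𝓝 (∫ x, ‖f x‖ ^ 2 ∂ν)) := by
  have e : ∀ {u : X → F} (hu : MemLp u 2 ν), ∫ x, ‖u x‖ ^ 2 ∂ν = ‖hu.toLp u‖ ^ 2 := by
    intro u hu
    have h0 : 0 ≤ ∫ x, ‖u x‖ ^ 2 ∂ν := integral_nonneg fun x => sq_nonneg _
    rw [Lp.norm_toLp, hu.eLpNorm_eq_integral_rpow_norm (by simp) (by simp)]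
    simp only [ENNReal.toReal_ofNat, Real.rpow_two]
    rw [ENNReal.toReal_ofReal (Real.rpow_nonneg h0 _), ← Real.rpow_natCast, ← Real.rpow_mul h0]
    simp
  have h2 := ((Lp.tendsto_Lp_iff_tendsto_eLpNorm'' v hv f hf).2 h).norm.pow 2
  simp_rw [← e] at h2
  exact h2

end Limits

/-! ### Radial cutoffs. -/

section Cutoff

variable {n : ℕ}

/-- A smooth radial cutoff, equal to `1` on the ball of radius `R` and supported in the ball of
radius `2 R`. -/
def cutoff (R : ℝ) (x : 𝔼 n) : ℝ := Real.smoothTransition (2 - ‖R⁻¹ • x‖ ^ 2)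

lemma contDiff_cutoff (R : ℝ) : ContDiff ℝ ∞ (cutoff R : (𝔼 n) → ℝ) :=
  Real.smoothTransition.contDiff.comp
    (contDiff_const.sub ((contDiff_norm_sq ℝ).comp (contDiff_const_smul _)))

lemma cutoff_nonneg (R : ℝ) (x : 𝔼 n) : 0 ≤ cutoff R x := Real.smoothTransition.nonneg _

lemma cutoff_le_one (R : ℝ) (x : 𝔼 n) : cutoff R x ≤ 1 := Real.smoothTransition.le_one _

lemma cutoff_eq_one {R : ℝ} (hR : 0 < R) {x : 𝔼 n} (hx : ‖x‖ ≤ R) : cutoff R x = 1 := by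
  refine Real.smoothTransition.one_of_one_le ?_
  have : ‖R⁻¹ • x‖ ≤ 1 := by
    rw [norm_smul, Real.norm_of_nonneg (by positivity), inv_mul_le_one₀ hR]; exact hx
  have := pow_le_one₀ (n := 2) (norm_nonneg _) this
  linarith

lemma cutoff_eq_zero {R : ℝ} (hR : 0 < R) {x : 𝔼 n} (hx : x ∉ Metric.closedBall (0 : 𝔼 n) (2 * R)) :
    cutoff R x = 0 := by
  refine Real.smoothTransition.zero_of_nonpos ?_
  rw [mem_closedBall_zero_iff, not_le] at hx
  have : 2 ≤ ‖R⁻¹ • x‖ := by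
    rw [norm_smul, Real.norm_of_nonneg (by positivity), le_inv_mul_iff₀ hR]; linarith
  nlinarith

lemma hasCompactSupport_cutoff {R : ℝ} (hR : 0 < R) :
    HasCompactSupport (cutoff R : (𝔼 n) → ℝ) :=
  HasCompactSupport.intro (isCompact_closedBall _ _) fun _ hx => cutoff_eq_zero hR hx

lemma gradient_cutoff_eq_zero {R : ℝ} (hR : 0 < R) {x : 𝔼 n}
    (hx : x ∉ Metric.closedBall (0 : 𝔼 n) (2 * R)) : gradient (cutoff R) x = 0 := by
  have h : (cutoff R : (𝔼 n) → ℝ) =ᶠ[𝓝 x] fun _ => 0 := by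
    filter_upwards [Metric.isClosed_closedBall.isOpen_compl.mem_nhds hx] with y hy
    exact cutoff_eq_zero hR hy
  rw [h.gradient_eq]
  simp [gradient]

/-- `cutoff R` is a dilate of `cutoff 1`, so its gradient scales like `1 / R`. -/
lemma exists_norm_gradient_cutoff_le (n : ℕ) : ∃ K, 0 ≤ K ∧ ∀ R, 0 < R → ∀ x : 𝔼 n,
    ‖gradient (cutoff R) x‖ ≤ K / R := by
  have h1 : ContDiff ℝ 1 (cutoff 1 : (𝔼 n) → ℝ) := (contDiff_cutoff 1).of_le (by simp)
  obtain ⟨K, hK⟩ := (hasCompactSupport_gradient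
    (hasCompactSupport_cutoff (n := n) one_pos)).exists_bound_of_continuous (continuous_gradient h1)
  refine ⟨K, (norm_nonneg _).trans (hK 0), fun R hR x => ?_⟩
  have e : (cutoff R : (𝔼 n) → ℝ) = fun x => cutoff 1 (R⁻¹ • x) := by
    ext x; simp [cutoff]
  rw [e, (hasGradientAt_comp_smul (h1.differentiable (by simp) _)).gradient, norm_smul,
    Real.norm_of_nonneg (by positivity), div_eq_inv_mul]
  exact mul_le_mul_of_nonneg_left (hK _) (by positivity)

end Cutoff

/-! ### From smooth compactly supported functions to admissible ones. -/

section Approximation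

variable {n : ℕ} {α : ℝ} {w : (𝔼 n) → ℝ}

/-- The Gaussian factor is bounded below on a ball. Thus convergence in the norms of `mu w`, all
that the Sobolev completion provides, becomes convergence for `nu w` after a cutoff. -/
lemma nu_restrict_closedBall_le (hw : IsHomogeneousLogConcave α w) (R : ℝ) :
    ∃ c : ℝ≥0∞, c ≠ ⊤ ∧ (nu w).restrict (Metric.closedBall 0 R) ≤ c • mu w := by
  have hC := normConst_pos hw
  refine ⟨ENNReal.ofReal ((normConst w)⁻¹ * Real.exp (R ^ 2 / 2)), by simp,
    Measure.le_iff.2 fun s hs => ?_⟩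
  have hB : MeasurableSet (Metric.closedBall (0 : 𝔼 n) R) := Metric.isClosed_closedBall.measurableSet
  rw [Measure.restrict_apply hs, Measure.smul_apply, smul_eq_mul, mu_eq hw, withDensity_apply _ hs,
    ← lintegral_const_mul _ (by fun_prop), ← setLIntegral_one]
  refine le_trans ?_ (lintegral_mono_set (Set.inter_subset_left (t := Metric.closedBall 0 R)))
  refine setLIntegral_mono' (hs.inter hB) fun x hx => ?_
  rw [← ENNReal.ofReal_mul (by positivity), ENNReal.one_le_ofReal]
  have h1 : ‖x‖ ^ 2 ≤ R ^ 2 :=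
    pow_le_pow_left₀ (norm_nonneg _) (mem_closedBall_zero_iff.1 hx.2) 2
  have e : (normConst w)⁻¹ * Real.exp (R ^ 2 / 2) * (normConst w * Real.exp (-‖x‖ ^ 2 / 2))
      = Real.exp ((R ^ 2 - ‖x‖ ^ 2) / 2) := by
    rw [mul_mul_mul_comm, inv_mul_cancel₀ hC.ne', one_mul, ← Real.exp_add]; ring_nf
  rw [e, Real.one_le_exp_iff]
  linarith

/-- The constant precedes the target space `F`, so that one `c` serves both functions and gradients.
-/
lemma eLpNorm_nu_le (hw : IsHomogeneousLogConcave α w) (R : ℝ) :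
    ∃ c : ℝ≥0∞, c ≠ ⊤ ∧ ∀ {F : Type} [NormedAddCommGroup F] (φ : (𝔼 n) → F),
      (∀ x ∉ Metric.closedBall 0 R, φ x = 0) → eLpNorm φ 2 (nu w) ≤ c * eLpNorm φ 2 (mu w) := by
  obtain ⟨c, hc, hle⟩ := nu_restrict_closedBall_le hw R
  refine ⟨c ^ (1 / (2 : ℝ≥0∞)).toReal, by simp [hc], fun φ hφ => ?_⟩
  rw [← eLpNorm_restrict_eq_of_support_subset (s := Metric.closedBall 0 R) (μ := nu w)
    (fun x hx => by_contra fun h => hx (hφ x h))]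
  refine (eLpNorm_mono_measure φ hle).trans (le_of_eq ?_)
  rw [eLpNorm_smul_measure_of_ne_top (by simp), smul_eq_mul]

lemma memLp_nu_of_hasCompactSupport (hw : IsHomogeneousLogConcave α w) {F : Type*}
    [NormedAddCommGroup F] {φ : (𝔼 n) → F} (hφ : Continuous φ) (hc : HasCompactSupport φ) :
    MemLp φ 2 (nu w) := by
  have := isFiniteMeasureOnCompacts_nu hw
  exact hφ.memLp_of_hasCompactSupport hc

lemma aestronglyMeasurable_mul_log {ν : Measure (𝔼 n)} {φ : (𝔼 n) → ℝ}
    (hφ : AEStronglyMeasurable φ ν) :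
    AEStronglyMeasurable (fun x => φ x ^ 2 * Real.log (φ x ^ 2)) ν :=
  Real.continuous_mul_log.comp_aestronglyMeasurable (hφ.pow 2)

lemma memLp_cutoff_mul {ν : Measure (𝔼 n)} {f : (𝔼 n) → ℝ} (hf : MemLp f 2 ν) (R : ℝ) :
    MemLp (fun x => cutoff R x * f x) 2 ν :=
  hf.of_le ((contDiff_cutoff R).continuous.aestronglyMeasurable.mul hf.1) (ae_of_all _ fun x => by
    rw [norm_mul, Real.norm_of_nonneg (cutoff_nonneg R x)]
    exact mul_le_of_le_one_left (norm_nonneg _) (cutoff_le_one R x))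

lemma memLp_cutoff_gradient {ν : Measure (𝔼 n)} {f : (𝔼 n) → ℝ} {g : (𝔼 n) → 𝔼 n}
    (hf : MemLp f 2 ν) (hg : MemLp g 2 ν) {R : ℝ} (hR : 0 < R) :
    MemLp (fun x => cutoff R x • g x + f x • gradient (cutoff R) x) 2 ν := by
  obtain ⟨K, hK0, hK⟩ := exists_norm_gradient_cutoff_le n
  refine MemLp.add ?_ ?_
  · exact hg.of_le ((contDiff_cutoff R).continuous.aestronglyMeasurable.smul hg.1)
      (ae_of_all _ fun x => by
        rw [norm_smul, Real.norm_of_nonneg (cutoff_nonneg R x)]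
        exact mul_le_of_le_one_left (norm_nonneg _) (cutoff_le_one R x))
  · refine hf.of_le_mul (c := K / R) (hf.1.smul
      (continuous_gradient ((contDiff_cutoff R).of_le (by simp))).aestronglyMeasurable)
      (ae_of_all _ fun x => ?_)
    rw [norm_smul, mul_comm]
    exact mul_le_mul_of_nonneg_right (hK R hR x) (norm_nonneg _)

/-- A cut-off Sobolev function is a limit of smooth compactly supported functions in the Sobolev
norm of `ν`. -/
lemma exists_approx_cutoff (hw : IsHomogeneousLogConcave α w) {f : (𝔼 n) → ℝ} {g : (𝔼 n) → 𝔼 n}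
    (hfg : Admissible w f g) {R : ℝ} (hR : 0 < R) :
    ∃ v : ℕ → (𝔼 n) → ℝ, (∀ k, ContDiff ℝ 2 (v k)) ∧ (∀ k, HasCompactSupport (v k)) ∧
      (∀ k, ∀ x ∉ Metric.closedBall 0 (2 * R), v k x = 0) ∧
      (∀ᵐ x ∂(nu w), Tendsto (fun k => v k x) atTop (𝓝 (cutoff R x * f x))) ∧
      Tendsto (fun k => ∫ x, v k x ^ 2 ∂(nu w)) atTop
        (𝓝 (∫ x, (cutoff R x * f x) ^ 2 ∂(nu w))) ∧
      Tendsto (fun k => ∫ x, ‖gradient (v k) x‖ ^ 2 ∂(nu w)) atTop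
        (𝓝 (∫ x, ‖cutoff R x • g x + f x • gradient (cutoff R) x‖ ^ 2 ∂(nu w))) := by
  obtain ⟨⟨hfμ, hgμ, u, hu, hlim⟩, hfν, hgν⟩ := hfg
  obtain ⟨K, hK0, hK⟩ := exists_norm_gradient_cutoff_le n
  obtain ⟨c, hc, hle⟩ := eLpNorm_nu_le hw (2 * R)
  set v : ℕ → (𝔼 n) → ℝ := fun k x => cutoff R x * u k x
  have hv : ∀ k, ContDiff ℝ 2 (v k) := fun k =>
    contDiff_infty.1 ((contDiff_cutoff R).mul (hu k).1) 2
  have hvc : ∀ k, HasCompactSupport (v k) := fun k => (hu k).2.1.mul_left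
  have hv0 : ∀ k, ∀ x ∉ Metric.closedBall 0 (2 * R), v k x = 0 := fun k x hx => by
    simp [v, cutoff_eq_zero hR hx]
  have hvg : ∀ k x, gradient (v k) x = cutoff R x • gradient (u k) x
      + u k x • gradient (cutoff R) x := fun k x =>
    (hasGradientAt_mul ((contDiff_cutoff R).differentiable (by simp) x).hasGradientAt
      ((hu k).1.differentiable (by simp) x).hasGradientAt).gradient
  have hlim1 : Tendsto (fun k => eLpNorm (fun x => u k x - f x) 2 (mu w)) atTop (𝓝 0) :=
    tendsto_of_tendsto_of_tendsto_of_le_of_le tendsto_const_nhds hlim (fun _ => zero_le)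
      fun _ => le_self_add
  have hlim2 : Tendsto (fun k => eLpNorm (fun x => gradient (u k) x - g x) 2 (mu w)) atTop (𝓝 0) :=
    tendsto_of_tendsto_of_tendsto_of_le_of_le tendsto_const_nhds hlim (fun _ => zero_le)
      fun _ => le_add_self
  have conv1 : Tendsto (fun k => eLpNorm (fun x => v k x - cutoff R x * f x) 2 (nu w)) atTop
      (𝓝 0) := by
    have hl : Tendsto (fun k => c * eLpNorm (fun x => u k x - f x) 2 (mu w)) atTop (𝓝 0) := by
      simpa using ENNReal.Tendsto.const_mul hlim1 (Or.inr hc)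
    refine tendsto_of_tendsto_of_tendsto_of_le_of_le tendsto_const_nhds hl (fun _ => zero_le)
      fun k => ?_
    refine (hle _ fun x hx => by simp [v, cutoff_eq_zero hR hx]).trans (mul_le_mul_right ?_ _)
    refine eLpNorm_mono fun x => ?_
    rw [show v k x - cutoff R x * f x = cutoff R x * (u k x - f x) by ring, norm_mul,
      Real.norm_of_nonneg (cutoff_nonneg R x)]
    exact mul_le_of_le_one_left (norm_nonneg _) (cutoff_le_one R x)
  have conv2 : Tendsto (fun k => eLpNorm (fun x => gradient (v k) x -
      (cutoff R x • g x + f x • gradient (cutoff R) x)) 2 (nu w)) atTop (𝓝 0) := by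
    have hl : Tendsto (fun k => c * (eLpNorm (fun x => gradient (u k) x - g x) 2 (mu w)
        + ENNReal.ofReal (K / R) * eLpNorm (fun x => u k x - f x) 2 (mu w))) atTop (𝓝 0) := by
      have := ENNReal.Tendsto.const_mul (hlim2.add
        (ENNReal.Tendsto.const_mul hlim1 (Or.inr (ENNReal.ofReal_ne_top (r := K / R)))))
        (Or.inr hc)
      simpa using this
    refine tendsto_of_tendsto_of_tendsto_of_le_of_le tendsto_const_nhds hl (fun _ => zero_le)
      fun k => ?_
    refine (hle _ fun x hx => by
      simp [hvg, cutoff_eq_zero hR hx, gradient_cutoff_eq_zero hR hx]).trans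
      (mul_le_mul_right ?_ _)
    have e : (fun x => gradient (v k) x - (cutoff R x • g x + f x • gradient (cutoff R) x)) =
        (fun x => cutoff R x • (gradient (u k) x - g x)) +
          fun x => (u k x - f x) • gradient (cutoff R) x := by
      ext1 x
      simp only [hvg, Pi.add_apply]
      module
    have hcg := continuous_gradient (contDiff_infty.1 (contDiff_cutoff (n := n) R) 1)
    have hug := continuous_gradient (contDiff_infty.1 (hu k).1 1)
    rw [e]
    refine (eLpNorm_add_le ((contDiff_cutoff R).continuous.aestronglyMeasurable.smul
      (hug.aestronglyMeasurable.sub hgμ.1)) (((hu k).1.continuous.aestronglyMeasurable.sub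
      hfμ.1).smul hcg.aestronglyMeasurable) (by norm_num)).trans (add_le_add ?_ ?_)
    · refine eLpNorm_mono fun x => ?_
      change ‖cutoff R x • (gradient (u k) x - g x)‖ ≤ _
      rw [norm_smul, Real.norm_of_nonneg (cutoff_nonneg R x)]
      exact mul_le_of_le_one_left (norm_nonneg _) (cutoff_le_one R x)
    · refine eLpNorm_le_mul_eLpNorm_of_ae_le_mul (ae_of_all _ fun x => ?_) 2
      change ‖(u k x - f x) • gradient (cutoff R) x‖ ≤ _
      rw [norm_smul, mul_comm]
      exact mul_le_mul_of_nonneg_right (hK R hR x) (norm_nonneg _)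
  have hfR := memLp_cutoff_mul hfν R
  have hgR := memLp_cutoff_gradient hfν hgν hR
  have hvm : ∀ k, MemLp (v k) 2 (nu w) := fun k =>
    memLp_nu_of_hasCompactSupport hw (hv k).continuous (hvc k)
  have hvgm : ∀ k, MemLp (gradient (v k)) 2 (nu w) := fun k =>
    memLp_nu_of_hasCompactSupport hw (continuous_gradient ((hv k).of_le (by norm_num)))
      (hasCompactSupport_gradient (hvc k))
  have int1 := tendsto_integral_norm_sq_of_tendsto_eLpNorm hvm hfR conv1
  have int2 := tendsto_integral_norm_sq_of_tendsto_eLpNorm hvgm hgR conv2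
  simp only [Real.norm_eq_abs, sq_abs] at int1
  -- A subsequence converging almost everywhere, as Fatou's lemma requires.
  obtain ⟨ns, hns, hae⟩ := (tendstoInMeasure_of_tendsto_eLpNorm (by norm_num)
    (fun k => (hvm k).1) hfR.1 conv1).exists_seq_tendsto_ae
  exact ⟨fun k => v (ns k), fun k => hv _, fun k => hvc _, fun k => hv0 _, hae,
    int1.comp hns.tendsto_atTop, int2.comp hns.tendsto_atTop⟩

/-- Fatou's lemma along the smooth approximations. Since `r log r ≥ r - 1 ≥ -1` for `r ≥ 0`, adding
the indicator of a ball, which has finite integral, makes all the integrands nonnegative; the right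
side `Φ` is continuous in the mass and the energy. -/
lemma integral_mul_log_sq_cutoff_le (hw : IsHomogeneousLogConcave α w) {f : (𝔼 n) → ℝ}
    {g : (𝔼 n) → 𝔼 n} (hfg : Admissible w f g) {R t : ℝ} (hR : 0 < R) (ht : 0 < t) :
    ∫ x, (cutoff R x * f x) ^ 2 * Real.log ((cutoff R x * f x) ^ 2) ∂(nu w) ≤
      (∫ x, (cutoff R x * f x) ^ 2 ∂(nu w)) * (Real.log (∫ x, (cutoff R x * f x) ^ 2 ∂(nu w))
        + Real.log (normConst w) - (n + α) - (n + α) * Real.log t)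
      + 2 * t ^ 2 * ∫ x, ‖cutoff R x • g x + f x • gradient (cutoff R) x‖ ^ 2 ∂(nu w) := by
  obtain ⟨v, hv, hvc, hv0, hae, hm, hD⟩ := exists_approx_cutoff hw hfg hR
  have hfin := isFiniteMeasureOnCompacts_nu hw
  set B := Metric.closedBall (0 : 𝔼 n) (2 * R)
  have hB : MeasurableSet B := Metric.isClosed_closedBall.measurableSet
  have iB : Integrable (B.indicator fun _ => (1 : ℝ)) (nu w) := by
    rw [integrable_indicator_iff hB]
    exact integrableOn_const (isCompact_closedBall _ _).measure_lt_top.ne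
  set b := ∫ x, B.indicator (fun _ => (1 : ℝ)) x ∂(nu w)
  set h : (𝔼 n) → ℝ := fun x => cutoff R x * f x
  have hh0 : ∀ x ∉ B, h x = 0 := fun x hx => by simp [h, cutoff_eq_zero hR hx]
  set m := ∫ x, h x ^ 2 ∂(nu w)
  set D := ∫ x, ‖cutoff R x • g x + f x • gradient (cutoff R) x‖ ^ 2 ∂(nu w)
  have hnonneg : ∀ {φ : (𝔼 n) → ℝ}, (∀ x ∉ B, φ x = 0) →
      ∀ x, 0 ≤ φ x ^ 2 * Real.log (φ x ^ 2) + B.indicator (fun _ => (1 : ℝ)) x := by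
    intro φ hφ x
    by_cases hx : x ∈ B
    · rw [Set.indicator_of_mem hx]
      linarith [Real.self_sub_one_le_mul_log (sq_nonneg (φ x)), sq_nonneg (φ x)]
    · simp [hφ x hx, hx]
  set Φ : ℝ → ℝ → ℝ := fun m D => m * (Real.log m + Real.log (normConst w) - (n + α)
    - (n + α) * Real.log t) + 2 * t ^ 2 * D
  have hΦ : Continuous fun p : ℝ × ℝ => Φ p.1 p.2 := by
    have : (fun p : ℝ × ℝ => Φ p.1 p.2) = fun p : ℝ × ℝ => p.1 * Real.log p.1 + p.1 *
        (Real.log (normConst w) - (n + α) - (n + α) * Real.log t) + 2 * t ^ 2 * p.2 := by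
      ext p; simp only [Φ]; ring
    rw [this]
    have := Real.continuous_mul_log.comp (continuous_fst (X := ℝ) (Y := ℝ))
    exact (this.add (by fun_prop)).add (by fun_prop)
  have hΦlim : Tendsto (fun k => ENNReal.ofReal (Φ (∫ x, v k x ^ 2 ∂(nu w))
      (∫ x, ‖gradient (v k) x‖ ^ 2 ∂(nu w)) + b)) atTop (𝓝 (ENNReal.ofReal (Φ m D + b))) :=
    (ENNReal.continuous_ofReal.tendsto _).comp
      (((hΦ.tendsto (m, D)).comp (hm.prodMk_nhds hD)).add_const b)
  have key : ∫⁻ x, ENNReal.ofReal (h x ^ 2 * Real.log (h x ^ 2)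
      + B.indicator (fun _ => (1 : ℝ)) x) ∂(nu w) ≤ ENNReal.ofReal (Φ m D + b) := by
    refine lintegral_le_of_tendsto_ae (F := fun k x => ENNReal.ofReal (v k x ^ 2 *
      Real.log (v k x ^ 2) + B.indicator (fun _ => (1 : ℝ)) x)) (fun k => ?_) ?_ (fun k => ?_) hΦlim
    · exact (((aestronglyMeasurable_mul_log (hv k).continuous.aestronglyMeasurable).add
        iB.1).aemeasurable).ennreal_ofReal
    · filter_upwards [hae] with x hx
      exact (ENNReal.continuous_ofReal.tendsto _).comp
        (((Real.continuous_mul_log.tendsto _).comp (hx.pow 2)).add_const _)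
    · have i1 := integrable_mul_log_sq hw (hv k).continuous (hvc k)
      have i2 : Integrable (fun x => v k x ^ 2 * Real.log (v k x ^ 2)
        + B.indicator (fun _ => (1 : ℝ)) x) (nu w) := i1.add iB
      rw [← ofReal_integral_eq_lintegral_ofReal i2 (ae_of_all _ (hnonneg (hv0 k))),
        integral_add i1 iB]
      exact ENNReal.ofReal_le_ofReal
        (add_le_add_left (integral_mul_log_sq_le hw (hv k) (hvc k) ht) _)
  have hmeas : AEStronglyMeasurable (fun x => h x ^ 2 * Real.log (h x ^ 2)) (nu w) :=
    aestronglyMeasurable_mul_log (memLp_cutoff_mul hfg.2.1 R).1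
  have i3 : Integrable (fun x => h x ^ 2 * Real.log (h x ^ 2)
      + B.indicator (fun _ => (1 : ℝ)) x) (nu w) := by
    refine ⟨hmeas.add iB.1, ?_⟩
    rw [hasFiniteIntegral_iff_ofReal (ae_of_all _ (hnonneg hh0))]
    exact key.trans_lt ENNReal.ofReal_lt_top
  have i4 : Integrable (fun x => h x ^ 2 * Real.log (h x ^ 2)) (nu w) := by
    exact (i3.sub iB).congr (ae_of_all _ fun x => add_sub_cancel_right _ _)
  rw [← ofReal_integral_eq_lintegral_ofReal i3 (ae_of_all _ (hnonneg hh0)),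
    integral_add i4 iB] at key
  -- Removing `ENNReal.ofReal` needs a nonnegative right side; it is a limit of nonnegative
  -- quantities.
  have hb0 : 0 ≤ Φ m D + b := by
    have hk : ∀ k, 0 ≤ Φ (∫ x, v k x ^ 2 ∂(nu w)) (∫ x, ‖gradient (v k) x‖ ^ 2 ∂(nu w)) + b := by
      intro k
      have i1 := integrable_mul_log_sq hw (hv k).continuous (hvc k)
      have h1 : 0 ≤ ∫ x, (v k x ^ 2 * Real.log (v k x ^ 2)
        + B.indicator (fun _ => (1 : ℝ)) x) ∂(nu w) := integral_nonneg (hnonneg (hv0 k))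
      rw [integral_add i1 iB] at h1
      exact h1.trans (add_le_add_left (integral_mul_log_sq_le hw (hv k) (hvc k) ht) _)
    exact ge_of_tendsto' (((hΦ.tendsto (m, D)).comp (hm.prodMk_nhds hD)).add_const b) hk
  have := (ENNReal.ofReal_le_ofReal_iff hb0).1 key
  change _ ≤ Φ m D
  linarith

lemma entPos_sq_cutoff_le (hw : IsHomogeneousLogConcave α w) {a b : ℝ}
    (hab : ∀ f : (𝔼 n) → ℝ, ContDiff ℝ 2 f → HasCompactSupport f →
      entPos (nu w) (fun x => f x ^ 2) ≤ ENNReal.ofReal ((∫ x, f x ^ 2 ∂(nu w)) ^ 2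
        + a * (∫ x, f x ^ 2 ∂(nu w)) + b * ∫ x, ‖gradient f x‖ ^ 2 ∂(nu w)))
    {f : (𝔼 n) → ℝ} {g : (𝔼 n) → 𝔼 n} (hfg : Admissible w f g) {R : ℝ} (hR : 0 < R) :
    entPos (nu w) (fun x => (cutoff R x * f x) ^ 2) ≤ ENNReal.ofReal
      ((∫ x, (cutoff R x * f x) ^ 2 ∂(nu w)) ^ 2 + a * (∫ x, (cutoff R x * f x) ^ 2 ∂(nu w))
        + b * ∫ x, ‖cutoff R x • g x + f x • gradient (cutoff R) x‖ ^ 2 ∂(nu w)) := by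
  obtain ⟨v, hv, hvc, hv0, hae, hm, hD⟩ := exists_approx_cutoff hw hfg hR
  refine lintegral_le_of_tendsto_ae (F := fun k x => ENNReal.ofReal (v k x ^ 2 *
    Real.log (v k x ^ 2))) (fun k => ?_) ?_ (fun k => hab (v k) (hv k) (hvc k)) ?_
  · exact (aestronglyMeasurable_mul_log
      (hv k).continuous.aestronglyMeasurable).aemeasurable.ennreal_ofReal
  · filter_upwards [hae] with x hx
    exact (ENNReal.continuous_ofReal.tendsto _).comp
      ((Real.continuous_mul_log.tendsto _).comp (hx.pow 2))
  · exact (ENNReal.continuous_ofReal.tendsto _).comp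
      (((hm.pow 2).add (hm.const_mul a)).add (hD.const_mul b))

lemma eventually_cutoff_eq_one (x : 𝔼 n) : ∀ᶠ k : ℕ in atTop, cutoff ((k : ℝ) + 1) x = 1 := by
  filter_upwards [eventually_ge_atTop ⌈‖x‖⌉₊] with k hk
  refine cutoff_eq_one (by positivity) ?_
  have : (⌈‖x‖⌉₊ : ℝ) ≤ k := by exact_mod_cast hk
  linarith [Nat.le_ceil ‖x‖]

lemma tendsto_integral_cutoff_sq {ν : Measure (𝔼 n)} {f : (𝔼 n) → ℝ} (hf : MemLp f 2 ν) :
    Tendsto (fun k : ℕ => ∫ x, (cutoff ((k : ℝ) + 1) x * f x) ^ 2 ∂ν) atTop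
      (𝓝 (∫ x, f x ^ 2 ∂ν)) := by
  refine tendsto_integral_of_dominated_convergence _
    (fun k => ((memLp_cutoff_mul hf _).1.pow 2)) hf.integrable_sq (fun k => ae_of_all _ fun x => ?_)
    (ae_of_all _ fun x => ?_)
  · rw [Real.norm_of_nonneg (sq_nonneg _), mul_pow]
    exact mul_le_of_le_one_left (sq_nonneg _)
      (pow_le_one₀ (cutoff_nonneg _ x) (cutoff_le_one _ x))
  · refine tendsto_const_nhds.congr' ?_
    filter_upwards [eventually_cutoff_eq_one x] with k hk
    rw [hk, one_mul]

lemma tendsto_integral_cutoff_gradient {ν : Measure (𝔼 n)} {f : (𝔼 n) → ℝ} {g : (𝔼 n) → 𝔼 n}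
    (hf : MemLp f 2 ν) (hg : MemLp g 2 ν) :
    Tendsto (fun k : ℕ => ∫ x, ‖cutoff ((k : ℝ) + 1) x • g x
      + f x • gradient (cutoff ((k : ℝ) + 1)) x‖ ^ 2 ∂ν) atTop (𝓝 (∫ x, ‖g x‖ ^ 2 ∂ν)) := by
  obtain ⟨K, hK0, hK⟩ := exists_norm_gradient_cutoff_le n
  have hbound : ∀ (k : ℕ) x, ‖gradient (cutoff ((k : ℝ) + 1)) x‖ ≤ K / ((k : ℝ) + 1) := fun k x =>
    hK _ (by positivity) x
  have hg2 := hg.integrable_norm_pow (p := 2) (by norm_num)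
  refine tendsto_integral_of_dominated_convergence
    (fun x => 2 * ‖g x‖ ^ 2 + 2 * K ^ 2 * f x ^ 2)
    (fun k => ((memLp_cutoff_gradient hf hg (by positivity)).1.norm.pow 2))
    ((hg2.const_mul 2).add (hf.integrable_sq.const_mul _)) (fun k => ae_of_all _ fun x => ?_)
    (ae_of_all _ fun x => ?_)
  · rw [Real.norm_of_nonneg (sq_nonneg _)]
    have h1 : ‖cutoff ((k : ℝ) + 1) x • g x‖ ≤ ‖g x‖ := by
      rw [norm_smul, Real.norm_of_nonneg (cutoff_nonneg _ x)]
      exact mul_le_of_le_one_left (norm_nonneg _) (cutoff_le_one _ x)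
    have h2 : ‖f x • gradient (cutoff ((k : ℝ) + 1)) x‖ ≤ K * |f x| := by
      rw [norm_smul, mul_comm, Real.norm_eq_abs]
      refine mul_le_mul_of_nonneg_right ((hbound k x).trans ?_) (abs_nonneg _)
      exact div_le_self hK0 (by linarith [(Nat.cast_nonneg k : (0 : ℝ) ≤ k)])
    have h3 := (norm_add_le _ _).trans (add_le_add h1 h2)
    calc _ ≤ (‖g x‖ + K * |f x|) ^ 2 := pow_le_pow_left₀ (norm_nonneg _) h3 2
      _ ≤ 2 * ‖g x‖ ^ 2 + 2 * K ^ 2 * |f x| ^ 2 := by nlinarith [sq_nonneg (‖g x‖ - K * |f x|)]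
      _ = _ := by rw [sq_abs]
  · have h1 : Tendsto (fun k : ℕ => cutoff ((k : ℝ) + 1) x) atTop (𝓝 1) :=
      tendsto_const_nhds.congr' ((eventually_cutoff_eq_one x).mono fun k hk => hk.symm)
    have h2 : Tendsto (fun k : ℕ => gradient (cutoff ((k : ℝ) + 1)) x) atTop (𝓝 0) := by
      refine squeeze_zero_norm (hbound · x) ?_
      simpa [div_eq_mul_inv] using tendsto_one_div_add_atTop_nhds_zero_nat.const_mul K
    have := (((h1.smul_const (g x)).add (h2.const_smul (f x))).norm).pow 2
    simpa using this

/-- Fatou's lemma as the cutoff radius `k + 1` tends to infinity, with constants `a` and `b`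
independent of the radius. -/
lemma entPos_lt_top (hw : IsHomogeneousLogConcave α w) {f : (𝔼 n) → ℝ} {g : (𝔼 n) → 𝔼 n}
    (hfg : Admissible w f g) : entPos (nu w) (fun x => f x ^ 2) < ⊤ := by
  obtain ⟨a, b, hab⟩ := entPos_sq_le hw
  have hm := tendsto_integral_cutoff_sq hfg.2.1
  have hD := tendsto_integral_cutoff_gradient hfg.2.1 hfg.2.2
  refine lt_of_le_of_lt (lintegral_le_of_tendsto_ae (F := fun k x =>
    ENNReal.ofReal ((cutoff ((k : ℝ) + 1) x * f x) ^ 2 *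
      Real.log ((cutoff ((k : ℝ) + 1) x * f x) ^ 2))) (fun k => ?_) (ae_of_all _ fun x => ?_)
    (fun k => entPos_sq_cutoff_le hw hab hfg (by positivity))
    ((ENNReal.continuous_ofReal.tendsto _).comp
      (((hm.pow 2).add (hm.const_mul a)).add (hD.const_mul b)))) ENNReal.ofReal_lt_top
  · exact (aestronglyMeasurable_mul_log
      (memLp_cutoff_mul hfg.2.1 _).1).aemeasurable.ennreal_ofReal
  · refine tendsto_const_nhds.congr' ?_
    filter_upwards [eventually_cutoff_eq_one x] with k hk
    rw [hk, one_mul]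

lemma integrable_mul_log_of_entNeg (hw : IsHomogeneousLogConcave α w) {f : (𝔼 n) → ℝ}
    {g : (𝔼 n) → 𝔼 n} (hfg : Admissible w f g)
    (hneg : entNeg (nu w) (fun x => f x ^ 2) ≠ ⊤) :
    Integrable (fun x => f x ^ 2 * Real.log (f x ^ 2)) (nu w) := by
  have hmeas := aestronglyMeasurable_mul_log hfg.2.1.1
  refine ⟨hmeas, ?_⟩
  have e : ∀ r : ℝ, ‖r‖ₑ = ENNReal.ofReal r + ENNReal.ofReal (-r) := fun r => by
    rw [Real.enorm_eq_ofReal_abs]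
    rcases le_total 0 r with h | h
    · rw [abs_of_nonneg h, ENNReal.ofReal_of_nonpos (neg_nonpos.2 h), add_zero]
    · rw [abs_of_nonpos h, ENNReal.ofReal_of_nonpos h, zero_add]
  rw [HasFiniteIntegral]
  simp_rw [e]
  rw [lintegral_add_left' hmeas.aemeasurable.ennreal_ofReal]
  exact ENNReal.add_lt_top.2 ⟨entPos_lt_top hw hfg, hneg.lt_top⟩

/-- The additive form of the logarithmic Sobolev inequality for admissible functions. -/
lemma integral_mul_log_sq_le_of_admissible (hw : IsHomogeneousLogConcave α w) {f : (𝔼 n) → ℝ}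
    {g : (𝔼 n) → 𝔼 n} (hfg : Admissible w f g)
    (hint : Integrable (fun x => f x ^ 2 * Real.log (f x ^ 2)) (nu w)) {t : ℝ} (ht : 0 < t) :
    ∫ x, f x ^ 2 * Real.log (f x ^ 2) ∂(nu w) ≤
      (∫ x, f x ^ 2 ∂(nu w)) * (Real.log (∫ x, f x ^ 2 ∂(nu w)) + Real.log (normConst w)
        - (n + α) - (n + α) * Real.log t) + 2 * t ^ 2 * ∫ x, ‖g x‖ ^ 2 ∂(nu w) := by
  have hm := tendsto_integral_cutoff_sq hfg.2.1
  have hD := tendsto_integral_cutoff_gradient hfg.2.1 hfg.2.2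
  have hf := hfg.2.1
  have hdom : Integrable (fun x => ‖f x ^ 2 * Real.log (f x ^ 2)‖ + f x ^ 2) (nu w) :=
    Integrable.add hint.norm hf.integrable_sq
  have hI : Tendsto (fun k : ℕ => ∫ x, (cutoff ((k : ℝ) + 1) x * f x) ^ 2 *
      Real.log ((cutoff ((k : ℝ) + 1) x * f x) ^ 2) ∂(nu w)) atTop
      (𝓝 (∫ x, f x ^ 2 * Real.log (f x ^ 2) ∂(nu w))) := by
    refine tendsto_integral_of_dominated_convergence
      (fun x => ‖f x ^ 2 * Real.log (f x ^ 2)‖ + f x ^ 2)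
      (fun k => aestronglyMeasurable_mul_log (memLp_cutoff_mul hfg.2.1 _).1)
      hdom (fun k => ae_of_all _ fun x => ?_)
      (ae_of_all _ fun x => ?_)
    · set c := cutoff ((k : ℝ) + 1) x ^ 2
      have hc0 : 0 ≤ c := sq_nonneg _
      have hc1 : c ≤ 1 := pow_le_one₀ (cutoff_nonneg _ x) (cutoff_le_one _ x)
      have hy : 0 ≤ f x ^ 2 := sq_nonneg _
      -- Splitting the logarithm of the product, with `|c log c| ≤ 1` on `[0, 1]`, gives the
      -- dominating function `|f² log f²| + f²`.
      have e : (cutoff ((k : ℝ) + 1) x * f x) ^ 2 * Real.log ((cutoff ((k : ℝ) + 1) x * f x) ^ 2)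
          = c * (f x ^ 2 * Real.log (f x ^ 2)) + f x ^ 2 * (c * Real.log c) := by
        rw [mul_pow]
        change c * f x ^ 2 * Real.log (c * f x ^ 2) = _
        rcases eq_or_ne c 0 with h0 | h0
        · simp [h0]
        rcases eq_or_ne (f x ^ 2) 0 with h1 | h1
        · simp [h1]
        rw [Real.log_mul h0 h1]; ring
      have hcl : |c * Real.log c| ≤ 1 := by
        rw [abs_le]
        have := Real.self_sub_one_le_mul_log hc0
        have := mul_nonpos_of_nonneg_of_nonpos hc0 (Real.log_nonpos hc0 hc1)
        constructor <;> linarith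
      rw [e, Real.norm_eq_abs, Real.norm_eq_abs]
      refine (abs_add_le _ _).trans (add_le_add ?_ ?_)
      · rw [abs_mul, abs_of_nonneg hc0]
        exact mul_le_of_le_one_left (abs_nonneg _) hc1
      · rw [abs_mul, abs_of_nonneg hy]
        exact mul_le_of_le_one_right hy hcl
    · refine tendsto_const_nhds.congr' ?_
      filter_upwards [eventually_cutoff_eq_one x] with k hk
      rw [hk, one_mul]
  have hml := (Real.continuous_mul_log.tendsto (∫ x, f x ^ 2 ∂(nu w))).comp hm
  have hR := (hml.add (hm.mul_const (Real.log (normConst w) - (n + α) - (n + α) * Real.log t))).add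
    (hD.const_mul (2 * t ^ 2))
  have := le_of_tendsto_of_tendsto' hI hR fun k => by
    refine (integral_mul_log_sq_cutoff_le hw hfg (by positivity) ht).trans (le_of_eq ?_)
    simp only [Function.comp]
    ring
  refine this.trans (le_of_eq ?_)
  ring

end Approximation

/-! ### Optimization over the scale, and the sharp inequality. -/

section Inequality

variable {n : ℕ} {α : ℝ} {w : (𝔼 n) → ℝ}

lemma ent_eq_of_integrable {ν : Measure (𝔼 n)} {φ : (𝔼 n) → ℝ}
    (h : Integrable (fun x => φ x * Real.log (φ x)) ν) :
    ent ν φ = ((∫ x, φ x * Real.log (φ x) ∂ν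
      - (∫ x, φ x ∂ν) * Real.log (∫ x, φ x ∂ν) : ℝ) : EReal) := by
  have h1 : entPos ν φ ≠ ⊤ := h.lintegral_lt_top.ne
  have h2 : entNeg ν φ ≠ ⊤ := h.neg.lintegral_lt_top.ne
  rw [ent, ← EReal.coe_ennreal_toReal h1, ← EReal.coe_ennreal_toReal h2, ← EReal.coe_sub,
    ← EReal.coe_sub, integral_eq_lintegral_pos_part_sub_lintegral_neg_part h]
  rfl

/-- Optimization of the additive inequality over the scale. -/
lemma le_optimized {N m D I L : ℝ} (hN : 0 < N) (hm : 0 ≤ m) (hD : 0 ≤ D)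
    (h : ∀ t : ℝ, 0 < t →
      I ≤ m * (Real.log m + L - N - N * Real.log t) + 2 * t ^ 2 * D) :
    I - m * Real.log m ≤ N / 2 * m * Real.log (4 * Real.exp (2 / N * L) / (Real.exp 1 * N)
      * (D / m)) := by
  rcases hm.eq_or_lt with rfl | hm
  · have hlim : Tendsto (fun t : ℝ => 2 * t ^ 2 * D) (𝓝[>] 0) (𝓝 0) := by
      have : Continuous fun t : ℝ => 2 * t ^ 2 * D := by fun_prop
      simpa using (this.tendsto 0).mono_left nhdsWithin_le_nhds
    have : I ≤ 0 := ge_of_tendsto hlim (by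
      filter_upwards [self_mem_nhdsWithin] with t ht
      simpa using h t ht)
    simpa using this
  rcases hD.eq_or_lt with rfl | hD
  -- For `D = 0 < m` the bound tends to `-∞` as `t → ∞`; the scale `e^s` is chosen so that it reads
  -- `I ≤ I - 1`.
  · exfalso
    set s := (m * (Real.log m + L - N) - I + 1) / (m * N)
    have h1 := h (Real.exp s) (Real.exp_pos _)
    rw [Real.log_exp, mul_zero, add_zero] at h1
    have e : m * (N * s) = m * (Real.log m + L - N) - I + 1 := by
      simp only [s]; field_simp
    linarith
  -- The minimizer of `-N m log t + 2 t² D` has `t² = N m / (4 D)`.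
  · set r := N * m / (4 * D)
    have hr : 0 < r := by positivity
    have h1 := h (Real.sqrt r) (Real.sqrt_pos.2 hr)
    rw [Real.sq_sqrt hr.le, Real.log_sqrt hr.le] at h1
    have e1 : 2 * r * D = N * m / 2 := by simp only [r]; field_simp; ring
    have e2 : 4 * Real.exp (2 / N * L) / (Real.exp 1 * N) * (D / m)
        = Real.exp (2 / N * L - 1) * r⁻¹ := by
      rw [Real.exp_sub]; simp only [r]; field_simp
    rw [e2, Real.log_mul (Real.exp_ne_zero _) (by positivity), Real.log_exp, Real.log_inv]
    have e3 : N / 2 * m * (2 / N * L - 1 + -Real.log r)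
        = m * L - N / 2 * m - N / 2 * m * Real.log r := by field_simp; ring
    rw [e1] at h1
    rw [e3]
    linarith

lemma sharpConst_eq (hw : IsHomogeneousLogConcave α w) :
    sharpConst w α = 4 * Real.exp (2 / (n + α) * Real.log (normConst w))
      / (Real.exp 1 * (n + α)) := by
  rw [sharpConst, Real.rpow_def_of_pos (normConst_pos hw), mul_comm (Real.log _)]

lemma dim_pos (hn : 1 ≤ n) (hw : IsHomogeneousLogConcave α w) : 0 < (n : ℝ) + α := by
  have : (1 : ℝ) ≤ n := by exact_mod_cast hn
  linarith [hw.degree_nonneg]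

lemma sharpConst_pos (hn : 1 ≤ n) (hw : IsHomogeneousLogConcave α w) : 0 < sharpConst w α := by
  have := dim_pos hn hw
  rw [sharpConst_eq hw]
  positivity

/-- The sharp logarithmic Sobolev inequality for homogeneous log-concave weights. -/
theorem lsi_sharpConst (hn : 1 ≤ n) (hw : IsHomogeneousLogConcave α w) :
    LSI w α (sharpConst w α) := by
  intro f g hfg
  -- With an infinite negative part the entropy is `⊥` and the inequality is trivial; otherwise `f²
  -- log f²` is integrable.
  by_cases hneg : entNeg (nu w) (fun x => f x ^ 2) = ⊤
  · rw [ent, hneg, EReal.coe_ennreal_top, EReal.sub_top, EReal.bot_sub]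
    exact bot_le
  have hint := integrable_mul_log_of_entNeg hw hfg hneg
  rw [ent_eq_of_integrable hint, EReal.coe_le_coe_iff, lsiRHS, sharpConst_eq hw]
  exact le_optimized (dim_pos hn hw) (integral_nonneg fun x => sq_nonneg _)
    (integral_nonneg fun x => sq_nonneg _)
    fun t ht => integral_mul_log_sq_le_of_admissible hw hfg hint ht

end Inequality

/-! ### Gaussians: admissibility, equality and sharpness. -/

section Gaussian

variable {n : ℕ} {α : ℝ} {w : (𝔼 n) → ℝ}

lemma mul_exp_neg_le {c r : ℝ} (hc : 0 < c) :
    r * Real.exp (-c * r) ≤ 2 / c * Real.exp (-(c / 2) * r) := by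
  have h1 : c / 2 * r ≤ Real.exp (c / 2 * r) := by linarith [Real.add_one_le_exp (c / 2 * r)]
  have h2 : r ≤ 2 / c * Real.exp (c / 2 * r) := by
    have := mul_le_mul_of_nonneg_left h1 (by positivity : 0 ≤ 2 / c)
    have e : 2 / c * (c / 2 * r) = r := by field_simp
    linarith
  refine (mul_le_mul_of_nonneg_right h2 (Real.exp_nonneg _)).trans (le_of_eq ?_)
  rw [mul_assoc, ← Real.exp_add]
  ring_nf

lemma integrable_nu_norm_sq_mul_exp (hw : IsHomogeneousLogConcave α w) {c : ℝ} (hc : 0 < c) :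
    Integrable (fun x => ‖x‖ ^ 2 * Real.exp (-c * ‖x‖ ^ 2)) (nu w) :=
  integrable_nu_of_le hw (by fun_prop) (half_pos hc) fun x => by
    rw [Real.norm_of_nonneg (by positivity)]
    exact mul_exp_neg_le hc

lemma integrable_nu_norm_sq_mul_gauss (hw : IsHomogeneousLogConcave α w) :
    Integrable (fun x => ‖x‖ ^ 2 * Real.exp (-‖x‖ ^ 2 / 2)) (nu w) := by
  convert integrable_nu_norm_sq_mul_exp hw (half_pos one_pos) using 4
  ring

/-- The second moment of the weighted Gaussian. -/
lemma integral_norm_sq_mul_gauss (hw : IsHomogeneousLogConcave α w) :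
    ∫ x, ‖x‖ ^ 2 * Real.exp (-‖x‖ ^ 2 / 2) ∂(nu w)
      = (n + α) * ∫ x, Real.exp (-‖x‖ ^ 2 / 2) ∂(nu w) := by
  have hsm : ContDiff ℝ 1 fun x : 𝔼 n => Real.exp (-‖x‖ ^ 2 / 2) :=
    (((contDiff_norm_sq ℝ).neg).div_const 2).exp
  have hfd : ∀ x y : 𝔼 n, fderiv ℝ (fun x : 𝔼 n => Real.exp (-‖x‖ ^ 2 / 2)) x y
      = -(Real.exp (-‖x‖ ^ 2 / 2) * inner ℝ x y) := fun x y => by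
    have h1 : HasDerivAt (fun r : ℝ => Real.exp (-r / 2)) (Real.exp (-‖x‖ ^ 2 / 2) * (-1 / 2))
      (‖x‖ ^ 2) := (((hasDerivAt_id' _).neg).div_const 2).exp
    rw [(hasGradientAt_comp_norm_sq h1).fderiv_apply, real_inner_smul_left]
    ring
  -- Euler's identity for the Gaussian, whose derivative along `x` is `-‖x‖²` times itself. For `1/2
  -- < t < 3/2`, `t² ≥ 1/4` gives the exponent `1/8` of the dominating function and `t ≤ 3/2` its
  -- factor.
  have key := integral_fderiv_apply_self hw hsm (integrable_nu_gauss hw)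
    ((integrable_nu_norm_sq_mul_exp hw (c := 1 / 8) (by norm_num)).const_mul (3 / 2))
    fun x t ht => by
      rw [Metric.mem_ball, Real.dist_eq, abs_lt] at ht
      rw [hfd, abs_neg, real_inner_smul_left, real_inner_self_eq_norm_sq, norm_smul, mul_pow,
        Real.norm_eq_abs, sq_abs, abs_of_nonneg (by
          have : 0 ≤ t := by linarith
          positivity)]
      have h1 : Real.exp (-(t ^ 2 * ‖x‖ ^ 2) / 2) ≤ Real.exp (-(1 / 8) * ‖x‖ ^ 2) := by
        rw [Real.exp_le_exp]
        have : (1 / 4 : ℝ) ≤ t ^ 2 := by nlinarith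
        nlinarith [sq_nonneg ‖x‖]
      have h2 : t * ‖x‖ ^ 2 ≤ 3 / 2 * ‖x‖ ^ 2 :=
        mul_le_mul_of_nonneg_right (by linarith) (sq_nonneg _)
      calc _ ≤ Real.exp (-(1 / 8) * ‖x‖ ^ 2) * (3 / 2 * ‖x‖ ^ 2) :=
            mul_le_mul h1 h2 (mul_nonneg (by linarith) (sq_nonneg _)) (Real.exp_nonneg _)
        _ = _ := by ring
  simp_rw [hfd, real_inner_self_eq_norm_sq] at key
  rw [integral_neg] at key
  simp_rw [mul_comm (‖_‖ ^ 2)]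
  linarith

lemma contDiff_gaussian (A : ℝ) : ContDiff ℝ ∞ (gaussian A : (𝔼 n) → ℝ) :=
  contDiff_const.mul (((contDiff_norm_sq ℝ).neg).div_const 4).exp

lemma hasGradientAt_gaussian (A : ℝ) (x : 𝔼 n) :
    HasGradientAt (gaussian A) ((-(1 / 2) * gaussian A x) • x) x := by
  have h1 : HasDerivAt (fun r : ℝ => A * Real.exp (-r / 4))
      (A * (Real.exp (-‖x‖ ^ 2 / 4) * (-1 / 4))) (‖x‖ ^ 2) :=
    ((((hasDerivAt_id' _).neg).div_const 4).exp).const_mul A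
  have h2 := hasGradientAt_comp_norm_sq h1
  have e : 2 * (A * (Real.exp (-‖x‖ ^ 2 / 4) * (-1 / 4))) = -(1 / 2) * gaussian A x := by
    rw [gaussian]; ring
  rw [e] at h2
  exact h2

lemma gaussian_sq (A : ℝ) (x : 𝔼 n) : gaussian A x ^ 2 = A ^ 2 * Real.exp (-‖x‖ ^ 2 / 2) := by
  rw [gaussian, mul_pow, ← Real.exp_nat_mul]
  congr 2
  push_cast; ring

lemma norm_gradient_gaussian_sq (A : ℝ) (x : 𝔼 n) : ‖gradient (gaussian A) x‖ ^ 2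
    = A ^ 2 / 4 * (‖x‖ ^ 2 * Real.exp (-‖x‖ ^ 2 / 2)) := by
  rw [(hasGradientAt_gaussian A x).gradient, norm_smul, mul_pow, Real.norm_eq_abs, sq_abs, mul_pow,
    gaussian_sq]
  ring

lemma memLp_gaussian (hw : IsHomogeneousLogConcave α w) (A : ℝ) :
    MemLp (gaussian A) 2 (nu w) := by
  rw [memLp_two_iff_integrable_sq_norm (contDiff_gaussian A).continuous.aestronglyMeasurable]
  simp_rw [Real.norm_eq_abs, sq_abs, gaussian_sq]
  exact (integrable_nu_gauss hw).const_mul _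

lemma memLp_gradient_gaussian (hw : IsHomogeneousLogConcave α w) (A : ℝ) :
    MemLp (gradient (gaussian A)) 2 (nu w) := by
  rw [memLp_two_iff_integrable_sq_norm
    (continuous_gradient (contDiff_infty.1 (contDiff_gaussian A) 1)).aestronglyMeasurable]
  simp_rw [norm_gradient_gaussian_sq]
  exact (integrable_nu_norm_sq_mul_gauss hw).const_mul _

lemma mu_le_smul_nu (hw : IsHomogeneousLogConcave α w) :
    mu w ≤ ENNReal.ofReal (normConst w) • nu w := by
  rw [mu_eq hw, ← withDensity_const]
  refine withDensity_mono (ae_of_all _ fun x => ENNReal.ofReal_le_ofReal ?_)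
  refine mul_le_of_le_one_right (normConst_pos hw).le (Real.exp_le_one_iff.2 ?_)
  have := sq_nonneg ‖x‖
  linarith

/-- The ray through `x` stays in the closed cone. Testing the normal inequality at `2x` and at `x /
2` gives both signs of `⟨η, x⟩`. -/
lemma inner_eq_zero_of_isOutwardNormal (hw : IsHomogeneousLogConcave α w) {x η : 𝔼 n}
    (hx : x ∈ frontier (support w)) (hη : IsOutwardNormal (support w) x η) :
    inner ℝ x η = 0 := by
  have hcl : ∀ y ∈ closure (support w), inner ℝ η (y - x) ≤ 0 := fun y hy =>
    closure_minimal (t := {y | inner ℝ η (y - x) ≤ 0}) hη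
      (isClosed_le (by fun_prop) continuous_const) hy
  have hsm : ∀ t : ℝ, 0 < t → inner ℝ η (t • x - x) ≤ 0 := fun t ht =>
    hcl _ (map_mem_closure (continuous_const_smul t) (frontier_subset_closure hx)
      fun y hy => smul_mem_support hw ht hy)
  have h1 := hsm 2 two_pos
  have h2 := hsm (1 / 2) (by norm_num)
  rw [inner_sub_right, real_inner_smul_right] at h1 h2
  rw [real_inner_comm]
  linarith

lemma isTestFunction_cutoff_mul_gaussian (hw : IsHomogeneousLogConcave α w) (A : ℝ) {R : ℝ}
    (hR : 0 < R) : IsTestFunction w fun x => cutoff R x * gaussian A x := by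
  refine ⟨(contDiff_cutoff R).mul (contDiff_gaussian A), (hasCompactSupport_cutoff hR).mul_right,
    fun x hx η hη => ?_⟩
  -- Written as a function of `‖x‖²`, the product has gradient parallel to `x`, which is orthogonal
  -- to `η`.
  set ψ : ℝ → ℝ := fun r =>
    Real.smoothTransition (2 - (R⁻¹) ^ 2 * r) * (A * Real.exp (-r / 4))
  have hψ : ContDiff ℝ 1 ψ :=
    ((Real.smoothTransition.contDiff (n := 1)).comp (by fun_prop)).mul (by fun_prop)
  have e : (fun x : 𝔼 n => cutoff R x * gaussian A x) = fun x => ψ (‖x‖ ^ 2) := by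
    ext x
    simp only [cutoff, gaussian, ψ, norm_smul, mul_pow, Real.norm_eq_abs, sq_abs]
  rw [e, (hasGradientAt_comp_norm_sq (hψ.differentiable (by simp) _).hasDerivAt).gradient,
    real_inner_smul_left, inner_eq_zero_of_isOutwardNormal hw hx hη, mul_zero]

lemma tendsto_eLpNorm_of_dominated {X F : Type*} [MeasurableSpace X] [NormedAddCommGroup F]
    {ν : Measure X} {h : ℕ → X → F} {b : X → ℝ} (hb : MemLp b 2 ν)
    (hm : ∀ k, AEStronglyMeasurable (h k) ν) (hle : ∀ k x, ‖h k x‖ ≤ b x)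
    (hlim : ∀ x, Tendsto (fun k => h k x) atTop (𝓝 0)) :
    Tendsto (fun k => eLpNorm (h k) 2 ν) atTop (𝓝 0) := by
  have hmem : ∀ k, MemLp (h k) 2 ν := fun k => hb.of_le (hm k) (ae_of_all _ fun x =>
    (hle k x).trans (le_abs_self _))
  have hint : Tendsto (fun k => ∫ x, ‖h k x‖ ^ 2 ∂ν) atTop (𝓝 0) := by
    have := tendsto_integral_of_dominated_convergence (fun x => b x ^ 2)
      (F := fun k x => ‖h k x‖ ^ 2) (f := fun _ => 0) (fun k => (hm k).norm.pow 2)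
      hb.integrable_sq (fun k => ae_of_all _ fun x => by
        rw [Real.norm_of_nonneg (sq_nonneg _)]
        exact pow_le_pow_left₀ (norm_nonneg _) (hle k x) 2)
      (ae_of_all _ fun x => by simpa using (hlim x).norm.pow 2)
    simpa using this
  have e : ∀ k, eLpNorm (h k) 2 ν = ENNReal.ofReal (Real.sqrt (∫ x, ‖h k x‖ ^ 2 ∂ν)) := fun k => by
    rw [(hmem k).eLpNorm_eq_integral_rpow_norm (by simp) (by simp), Real.sqrt_eq_rpow]
    simp
  simp_rw [e]
  have := (ENNReal.continuous_ofReal.comp Real.continuous_sqrt).tendsto 0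
  simp only [Function.comp, Real.sqrt_zero, ENNReal.ofReal_zero] at this
  exact this.comp hint

/-- The cut-off Gaussians are test functions and converge by dominated convergence; the gradients of
the cutoffs are bounded by `K` and tend to zero. -/
lemma admissible_gaussian (hw : IsHomogeneousLogConcave α w) (A : ℝ) :
    Admissible w (gaussian A) (gradient (gaussian A)) := by
  obtain ⟨K, hK0, hK⟩ := exists_norm_gradient_cutoff_le n
  have h1 := memLp_gaussian hw A
  have h2 := memLp_gradient_gaussian hw A
  have h1' := h1.of_measure_le_smul ENNReal.ofReal_ne_top (mu_le_smul_nu hw)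
  have h2' := h2.of_measure_le_smul ENNReal.ofReal_ne_top (mu_le_smul_nu hw)
  refine ⟨⟨h1', h2', fun k x => cutoff ((k : ℝ) + 1) x * gaussian A x,
    fun k => isTestFunction_cutoff_mul_gaussian hw A (by positivity), ?_⟩, h1, h2⟩
  have hg : ∀ (k : ℕ) (x : 𝔼 n), gradient (fun x => cutoff ((k : ℝ) + 1) x * gaussian A x) x
      = cutoff ((k : ℝ) + 1) x • gradient (gaussian A) x
        + gaussian A x • gradient (cutoff ((k : ℝ) + 1)) x := fun k x =>
    (hasGradientAt_mul ((contDiff_cutoff _).differentiable (by simp) x).hasGradientAt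
      ((contDiff_gaussian A).differentiable (by simp) x).hasGradientAt).gradient
  have hc1 : ∀ x : 𝔼 n, Tendsto (fun k : ℕ => cutoff ((k : ℝ) + 1) x) atTop (𝓝 1) := fun x =>
    tendsto_const_nhds.congr' ((eventually_cutoff_eq_one x).mono fun k hk => hk.symm)
  have hc2 : ∀ x : 𝔼 n, Tendsto (fun k : ℕ => gradient (cutoff ((k : ℝ) + 1)) x) atTop (𝓝 0) :=
    fun x => squeeze_zero_norm (fun k => hK _ (by positivity) x) (by
      simpa [div_eq_mul_inv] using tendsto_one_div_add_atTop_nhds_zero_nat.const_mul K)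
  have hcut : ∀ (k : ℕ) (x : 𝔼 n), |cutoff ((k : ℝ) + 1) x - 1| ≤ 1 := fun k x => by
    have := cutoff_nonneg ((k : ℝ) + 1) x
    have := cutoff_le_one ((k : ℝ) + 1) x
    rw [abs_le]; constructor <;> linarith
  have hgc := continuous_gradient (contDiff_infty.1 (contDiff_gaussian (n := n) A) 1)
  have t1 := tendsto_eLpNorm_of_dominated (ν := mu w)
    (h := fun (k : ℕ) x => cutoff ((k : ℝ) + 1) x * gaussian A x - gaussian A x)
    (b := fun x => ‖gaussian A x‖) h1'.norm
    (fun k => (((contDiff_cutoff _).mul (contDiff_gaussian A)).sub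
      (contDiff_gaussian A)).continuous.aestronglyMeasurable)
    (fun k x => by
      rw [← sub_one_mul, norm_mul]
      exact mul_le_of_le_one_left (norm_nonneg _) (hcut k x))
    (fun x => by simpa using ((hc1 x).mul_const (gaussian A x)).sub_const (gaussian A x))
  have t2 := tendsto_eLpNorm_of_dominated (ν := mu w)
    (h := fun (k : ℕ) x => gradient (fun x => cutoff ((k : ℝ) + 1) x * gaussian A x) x
      - gradient (gaussian A) x)
    (b := fun x => ‖gradient (gaussian A) x‖ + K * ‖gaussian A x‖)
    (h2'.norm.add (h1'.norm.const_mul K))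
    (fun k => ((continuous_gradient (contDiff_infty.1 ((contDiff_cutoff _).mul
      (contDiff_gaussian A)) 1)).sub hgc).aestronglyMeasurable)
    (fun k x => by
      have e : gradient (fun x => cutoff ((k : ℝ) + 1) x * gaussian A x) x
          - gradient (gaussian A) x = (cutoff ((k : ℝ) + 1) x - 1) • gradient (gaussian A) x
            + gaussian A x • gradient (cutoff ((k : ℝ) + 1)) x := by
        rw [hg]; module
      rw [e]
      refine (norm_add_le _ _).trans (add_le_add ?_ ?_)
      · rw [norm_smul]
        exact mul_le_of_le_one_left (norm_nonneg _) (hcut k x)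
      · rw [norm_smul, mul_comm]
        refine mul_le_mul_of_nonneg_right ((hK _ (by positivity) x).trans ?_) (norm_nonneg _)
        exact div_le_self hK0 (by linarith [(Nat.cast_nonneg k : (0 : ℝ) ≤ k)]))
    (fun x => by
      simp_rw [hg]
      simpa using (((hc1 x).smul_const (gradient (gaussian A) x)).add
        ((hc2 x).const_smul (gaussian A x))).sub_const (gradient (gaussian A) x))
  simpa using t1.add t2

/-- Gaussians are extremal. -/
lemma ent_gaussian (hn : 1 ≤ n) (hw : IsHomogeneousLogConcave α w) (A : ℝ) :
    ent (nu w) (fun x => gaussian A x ^ 2) = ((lsiRHS w α (sharpConst w α) (gaussian A)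
      (gradient (gaussian A)) : ℝ) : EReal) := by
  have hN := dim_pos hn hw
  have hC := normConst_pos hw
  have hZ : ∫ x, Real.exp (-‖x‖ ^ 2 / 2) ∂(nu w) = (normConst w)⁻¹ := by
    rw [normConst_eq hw, inv_inv]
  have hlog : ∀ x : 𝔼 n, gaussian A x ^ 2 * Real.log (gaussian A x ^ 2)
      = A ^ 2 * Real.log (A ^ 2) * Real.exp (-‖x‖ ^ 2 / 2)
        - A ^ 2 / 2 * (‖x‖ ^ 2 * Real.exp (-‖x‖ ^ 2 / 2)) := fun x => by
    rw [gaussian_sq]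
    rcases eq_or_ne A 0 with rfl | hA
    · simp
    · rw [Real.log_mul (by positivity) (Real.exp_ne_zero _), Real.log_exp]
      ring
  have i1 := (integrable_nu_gauss hw).const_mul (A ^ 2 * Real.log (A ^ 2))
  have i2 := (integrable_nu_norm_sq_mul_gauss hw).const_mul (A ^ 2 / 2)
  have hm : ∫ x, gaussian A x ^ 2 ∂(nu w) = A ^ 2 * (normConst w)⁻¹ := by
    simp_rw [gaussian_sq]
    rw [integral_const_mul, hZ]
  have hD : ∫ x, ‖gradient (gaussian A) x‖ ^ 2 ∂(nu w)
      = A ^ 2 / 4 * ((n + α) * (normConst w)⁻¹) := by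
    simp_rw [norm_gradient_gaussian_sq]
    rw [integral_const_mul, integral_norm_sq_mul_gauss hw, hZ]
  have hint : Integrable (fun x => gaussian A x ^ 2 * Real.log (gaussian A x ^ 2)) (nu w) := by
    simp_rw [hlog]
    exact i1.sub i2
  rw [ent_eq_of_integrable hint, lsiRHS, sharpConst_eq hw, hm, hD]
  simp_rw [hlog]
  rw [integral_sub i1 i2, integral_const_mul, integral_const_mul, integral_norm_sq_mul_gauss hw, hZ]
  congr 1
  rcases eq_or_ne A 0 with rfl | hA
  · simp
  -- For the Gaussian the argument of the logarithm is an exact exponential, so both sides become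
  -- explicit.
  have e : 4 * Real.exp (2 / (n + α) * Real.log (normConst w)) / (Real.exp 1 * (n + α)) *
      (A ^ 2 / 4 * ((n + α) * (normConst w)⁻¹) / (A ^ 2 * (normConst w)⁻¹))
      = Real.exp (2 / (n + α) * Real.log (normConst w) - 1) := by
    rw [Real.exp_sub]; field_simp
  rw [e, Real.log_exp, Real.log_mul (by positivity) (by positivity), Real.log_inv]
  field_simp
  ring

/-- The Gaussian with `A = 1` gives equality for `sharpConst`, and the right side depends on `C`
only through a positive multiple of `log C`, which is strictly increasing. -/
lemma sharpConst_le (hn : 1 ≤ n) (hw : IsHomogeneousLogConcave α w) {C : ℝ} (hC : 0 < C)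
    (h : LSI w α C) : sharpConst w α ≤ C := by
  have hN := dim_pos hn hw
  have hZ := integral_nu_gauss_pos hw
  have h1 := h _ _ (admissible_gaussian hw 1)
  rw [ent_gaussian hn hw, EReal.coe_le_coe_iff, lsiRHS, lsiRHS] at h1
  simp_rw [norm_gradient_gaussian_sq, gaussian_sq] at h1
  rw [integral_const_mul, integral_const_mul, integral_norm_sq_mul_gauss hw] at h1
  set Z := ∫ x, Real.exp (-‖x‖ ^ 2 / 2) ∂(nu w)
  have h2 := le_of_mul_le_mul_left h1 (by positivity)
  have hS := sharpConst_pos hn hw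
  rw [Real.log_le_log_iff (by positivity) (by positivity)] at h2
  exact le_of_mul_le_mul_right h2 (by positivity)

end Gaussian

end WeightedLSI

end

/-- The sharp logarithmic Sobolev inequality for log-concave homogeneous weights. The three parts:
`Ent_ν(f²)` is well defined in `[-∞, ∞)`; `C_LSIH` is the least constant for which the inequality
holds; Gaussians are admissible and give equality. -/
theorem theorem1p9 (n : ℕ) (hn : 1 ≤ n) (α : ℝ) (w : EuclideanSpace ℝ (Fin n) → ℝ)
    (hw : WeightedLSI.IsHomogeneousLogConcave α w) :
    (∀ (f : EuclideanSpace ℝ (Fin n) → ℝ)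
        (g : EuclideanSpace ℝ (Fin n) → EuclideanSpace ℝ (Fin n)),
      WeightedLSI.Admissible w f g →
        WeightedLSI.entPos (WeightedLSI.nu w) (fun x => f x ^ 2) < ⊤) ∧
    IsLeast {C : ℝ | 0 < C ∧ WeightedLSI.LSI w α C} (WeightedLSI.sharpConst w α) ∧
    (∀ A : ℝ,
      WeightedLSI.Admissible w (WeightedLSI.gaussian A) (gradient (WeightedLSI.gaussian A)) ∧
      WeightedLSI.ent (WeightedLSI.nu w) (fun x => WeightedLSI.gaussian A x ^ 2) =
        ((WeightedLSI.lsiRHS w α (WeightedLSI.sharpConst w α) (WeightedLSI.gaussian A)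
          (gradient (WeightedLSI.gaussian A)) : ℝ) : EReal)) := by
  exact ⟨fun f g hfg => WeightedLSI.entPos_lt_top hw hfg, ⟨⟨WeightedLSI.sharpConst_pos hn hw,
    WeightedLSI.lsi_sharpConst hn hw⟩, fun C hC => WeightedLSI.sharpConst_le hn hw hC.1 hC.2⟩,
    fun A => ⟨WeightedLSI.admissible_gaussian hw A, WeightedLSI.ent_gaussian hn hw A⟩⟩
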